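/- Let $n,d$ be positive integers with $nd$ even. In the configuration model of random $d$-regular multigraphs, take a set $U$ of $nd$ mini-vertices partitioned into $n$ classes of size $d$, choose a perfect matching $M$ of the complete graph on $U$ uniformly at random, and identify the elements of the $i$th class to a single vertex $v_i$; every edge $\{u,w\}$ of $M$ becomes one edge between the vertices of the classes of $u$ and $w$. The result is a random $d$-regular multigraph $G$ on $n$ labelled vertices, possibly with loops and multiple edges. The girth of a multigraph is the length of its shortest cycle, where a loop is a cycle of length $1$ and a pair of parallel edges is a cycle of length $2$. **Theorem.** Let $d\ge 3$ and $g\ge 3$ be integers, which may vary with $n$, where $n\to\infty$ with $nd$ even. (a) If $g^3d^{2g-3}=o(n)$, then $$\Pr\bigl(G\text{ has girth at least }g\bigr)=(1+o(1))\exp\Bigl(-\sum_{i=1}^{g-1}\frac{(d-1)^i}{2i}\Bigr).$$ (b) $G$ has girth at least $3$ if and only if $G$ is a simple graph. Consequently, if $d=o(n^{1/3})$, then $$\Pr(G\text{ is simple})=(1+o(1))\,e^{(1-d^2)/4},$$ and the number of labelled $d$-regular simple graphs on $n$ vertices is $$(1+o(1))\,e^{(1-d^2)/4}\,\frac{(dn)!}{(dn/2)!\,2^{dn/2}\,(d!)^n}.$$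 -/

import Mathlib

namespace ConfigModel

/-- A multigraph `G` (loops and parallel edges allowed) contains a cycle of length `k`: there are
`k ≥ 1` distinct vertices `v 0, …, v (k - 1)` and `k` distinct edges `e 0, …, e (k - 1)`, where
`e i` joins `v i` to its cyclic successor. So a cycle of length `1` is a loop and a cycle of
length `2` is a pair of distinct parallel edges between two distinct vertices. -/
def HasCycle {α β : Type*} (G : Graph α β) (k : ℕ) : Prop :=
  1 ≤ k ∧ ∃ (v : Fin k → α) (e : Fin k → β), Function.Injective v ∧ Function.Injective e ∧
    ∀ i : Fin k, G.IsLink (e i) (v i) (v (finRotate k i))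

/-- The girth of a multigraph: the length of its shortest cycle (`⊤` if there is no cycle). -/
noncomputable def girth {α β : Type*} (G : Graph α β) : ℕ∞ :=
  ⨅ (k : ℕ) (_ : HasCycle G k), (k : ℕ∞)

/-- The set of mini-vertices: `n` classes, indexed by the first coordinate, of `d` elements. -/
abbrev MiniVertex (n d : ℕ) : Type := Fin n × Fin d

/-- The perfect matchings of the complete graph on the mini-vertices. -/
abbrev Matching (n d : ℕ) : Type :=
  {M : (⊤ : SimpleGraph (MiniVertex n d)).Subgraph // M.IsPerfectMatching}

/-- The multigraph on the vertices `Fin n` associated with a matching: each edge `{u, w}` of the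
matching is kept as one edge, which now joins the class of `u` to the class of `w`. -/
def project {n d : ℕ} (M : Matching n d) : Graph (Fin n) (Sym2 (MiniVertex n d)) :=
  (Graph.ofSimpleGraph M.1.spanningCoe).map Prod.fst

/-- The probability that the random `d`-regular multigraph on `n` vertices, obtained by projecting
a uniformly random perfect matching of the (finitely many) mini-vertices, has the property `P`. -/
noncomputable def prob (n d : ℕ) (P : Graph (Fin n) (Sym2 (MiniVertex n d)) → Prop) : ℝ :=
  (Nat.card {M : Matching n d // P (project M)} : ℝ) / (Nat.card (Matching n d) : ℝ)

open Classical in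
/-- The number of labelled `d`-regular simple graphs on `n` vertices. -/
noncomputable def numRegularGraphs (n d : ℕ) : ℕ :=
  Nat.card {G : SimpleGraph (Fin n) // G.IsRegularOfDegree d}

end ConfigModel

/-! A matching is a fixed-point-free involution `P` of the `N = nd` mini-vertices, and a `k`-cycle
of the multigraph is a set of `k` prescribed edges of `P`. Forbid these sets one at a time, in order
of increasing length. At any stage the surviving matchings form `avoid c k T`: no cycle shorter than
`k`, and no member of the set `T` of `k`-cycles treated so far. Forbidding one more `k`-cycle `M`
multiplies the count by `1 - p`, where `p` is the proportion of survivors that contain `M`. The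
heart of the proof is that `p` is close to `N ^ (-k)` whatever `T` is; no inclusion-exclusion or
moment computation is needed.

Both bounds on `p` come from switchings, that is, conjugation of `P` by a transposition. For the
upper bound, `nearlyClosed_avoid` shows that all but `O(k d ^ k)` switchings removing a given edge
preserve `avoid c k T`; hence each prescribed edge costs a factor of at most `1 / D`, with `D = N -
O(k d ^ k)` (`card_contains_le`). For the lower bound, switch the edges of `M` into `P` one by one,
a map that is at most `N ^ k` to one. The result survives unless `P` has a short path between
elements of `M` (`bad_of_force_notMem`), and such `P` are rare by the upper bound technique
(`card_bad_le`, `le_card_contains`).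

Multiplying the factors `1 - p` gives `exp (-∑ (number of k-cycles) * p)` up to controlled errors
(`card_avoid_prod_bounds`). There are about `(n d (d-1)) ^ k / (2k)` cycles of length `k`, so the
exponent is `∑ (d-1) ^ k / (2k)` with error at most `14 X`, where `X = g ^ 3 d ^ (2g-3) / n`
(`card_avoid_estimate`). The statements on simple graphs are the case `g = 3`, together with the
fact that each `d`-regular simple graph arises from `(d!) ^ n` matchings. -/

namespace ConfigModel

set_option linter.unusedSectionVars false

open Finset

/-! ### Perfect matchings as involutions, and switchings -/

section PerfectMatchings

variable {α : Type*} [Fintype α] [DecidableEq α]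

/-- A perfect matching on `α`, seen as a fixed-point-free involution. -/
def IsPM (P : Equiv.Perm α) : Prop := (∀ x, P (P x) = x) ∧ ∀ x, P x ≠ x

instance (P : Equiv.Perm α) : Decidable (IsPM P) := by unfold IsPM; infer_instance

variable (α) in
/-- The set of all perfect matchings. -/
def perfectMatchings : Finset (Equiv.Perm α) := univ.filter IsPM

lemma mem_perfectMatchings {P : Equiv.Perm α} : P ∈ perfectMatchings α ↔ IsPM P := by
  simp [perfectMatchings]

/-- The switching of `P` which exchanges the roles of `z` and `v`. -/
def sw (P : Equiv.Perm α) (z v : α) : Equiv.Perm α := Equiv.swap z v * P * Equiv.swap z v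

lemma sw_apply (P : Equiv.Perm α) (z v x : α) :
    sw P z v x = Equiv.swap z v (P (Equiv.swap z v x)) := rfl

lemma sw_sw (P : Equiv.Perm α) (z v : α) : sw (sw P z v) z v = P := by
  ext x; simp [sw_apply]

lemma IsPM.sw {P : Equiv.Perm α} (h : IsPM P) (z v : α) : IsPM (sw P z v) := by
  refine ⟨fun x => by simp [sw_apply, h.1], fun x hx => ?_⟩
  rw [sw_apply, Equiv.swap_apply_eq_iff] at hx
  exact h.2 _ hx

lemma IsPM.eq_symm {P : Equiv.Perm α} (h : IsPM P) {a b : α} (hab : P a = b) : P b = a := by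
  rw [← hab, h.1]

/-- The vertices covered by a list of edges. -/
def verts : List (α × α) → Finset α
  | [] => ∅
  | e :: L => insert e.1 (insert e.2 (verts L))

/-- A list of edges is a matching. -/
def Valid : List (α × α) → Prop
  | [] => True
  | e :: L => e.1 ≠ e.2 ∧ e.1 ∉ verts L ∧ e.2 ∉ verts L ∧ Valid L

/-- `P` contains all the edges of the list. -/
def Ext (P : Equiv.Perm α) (L : List (α × α)) : Prop := ∀ e ∈ L, P e.1 = e.2

instance (P : Equiv.Perm α) (L : List (α × α)) : Decidable (Ext P L) := by
  unfold Ext; infer_instance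

lemma ext_cons {P : Equiv.Perm α} {e : α × α} {L : List (α × α)} :
    Ext P (e :: L) ↔ P e.1 = e.2 ∧ Ext P L := by simp [Ext]

lemma mem_verts {L : List (α × α)} {x : α} : x ∈ verts L ↔ ∃ e ∈ L, x = e.1 ∨ x = e.2 := by
  induction L with
  | nil => simp [verts]
  | cons e L ih => simp [verts, ih, or_assoc]

lemma card_verts_le (L : List (α × α)) : (verts L).card ≤ 2 * L.length := by
  induction L with
  | nil => simp [verts]
  | cons e L ih =>
    have h1 := card_insert_le e.1 (insert e.2 (verts L))
    have h2 := card_insert_le e.2 (verts L)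
    simp only [verts, List.length_cons]
    omega

lemma Ext.apply_mem {P : Equiv.Perm α} (hP : IsPM P) {L : List (α × α)} (h : Ext P L) {x : α}
    (hx : x ∈ verts L) : P x ∈ verts L := by
  rw [mem_verts] at hx ⊢
  obtain ⟨e, he, rfl | rfl⟩ := hx
  · exact ⟨e, he, Or.inr (h e he)⟩
  · exact ⟨e, he, Or.inl (hP.eq_symm (h e he))⟩

/-- The family `F` is nearly closed under switchings: from each member, all but `b` of the
switchings that remove a given edge stay in `F`. -/
def NearlyClosed (F : Finset (Equiv.Perm α)) (b : ℕ) : Prop :=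
  ∀ P ∈ F, ∀ u, (univ.filter fun z => z ≠ u ∧ sw P z (P u) ∉ F).card ≤ b

/-- Double counting of pairs `(P, z)`: switching `z` with `v` destroys the edge `uv`, unless `z =
v`, and keeps `L`. The pair can be recovered from the result, since `z` is the new partner of `u`
and switching is an involution. The excluded `z` are `u`, the vertices of `L` and at most `b`
others. -/
lemma card_ext_cons_le {F : Finset (Equiv.Perm α)} {b : ℕ}
    (hb : NearlyClosed F b) {e : α × α} {L : List (α × α)} (hL : Valid (e :: L)) :
    (F.filter fun P => Ext P (e :: L)).card * (Fintype.card α - (2 * L.length + 1 + b)) ≤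
      (F.filter fun P => Ext P L).card := by
  obtain ⟨u, v⟩ := e
  obtain ⟨huv, huL, hvL, hL'⟩ := hL
  simp only at huv huL hvL
  set Z : Equiv.Perm α → Finset α := fun P =>
    univ.filter fun z => z ≠ u ∧ z ∉ verts L ∧ sw P z v ∈ F with hZ
  have hcard : ∀ P ∈ F.filter (fun P => Ext P ((u, v) :: L)),
      Fintype.card α - (2 * L.length + 1 + b) ≤ (Z P).card := by
    intro P hP
    rw [mem_filter, ext_cons] at hP
    obtain ⟨hPF, hPu, hPL⟩ := hP
    have h1 := hb P hPF u
    have h2 := card_verts_le L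
    have h3 : (univ : Finset α) ⊆ Z P ∪ (insert u (verts L) ∪
        univ.filter fun z => z ≠ u ∧ sw P z (P u) ∉ F) := by
      intro z _
      simp only [hZ, mem_union, mem_filter, mem_univ, true_and, mem_insert]
      simp only at hPu
      rw [hPu]
      tauto
    have h4 := card_le_card h3
    have h5 := card_union_le (Z P) (insert u (verts L) ∪
        univ.filter fun z => z ≠ u ∧ sw P z (P u) ∉ F)
    have h6 := card_union_le (insert u (verts L))
        (univ.filter fun z => z ≠ u ∧ sw P z (P u) ∉ F)
    have h7 := card_insert_le u (verts L)
    rw [card_univ] at h4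
    omega
  have key : ((F.filter fun P => Ext P ((u, v) :: L)).sigma Z).card ≤
      (F.filter fun P => Ext P L).card := by
    refine card_le_card_of_injOn (fun x => sw x.1 x.2 v) ?_ ?_
    · rintro ⟨P, z⟩ h
      simp only [coe_sigma, Set.mem_sigma_iff, mem_coe, mem_filter, hZ, mem_univ, true_and,
        ext_cons] at h ⊢
      obtain ⟨⟨hPF, hPu, hPL⟩, hzu, hzL, hsw⟩ := h
      refine ⟨hsw, fun e he => ?_⟩
      have e1 : e.1 ∈ verts L := mem_verts.2 ⟨e, he, Or.inl rfl⟩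
      have e2 : e.2 ∈ verts L := mem_verts.2 ⟨e, he, Or.inr rfl⟩
      rw [sw_apply, Equiv.swap_apply_of_ne_of_ne (x := e.1), hPL e he, Equiv.swap_apply_of_ne_of_ne] <;>
        (rintro h; simp_all)
    · rintro ⟨P, z⟩ h ⟨P', z'⟩ h' heq
      simp only [coe_sigma, Set.mem_sigma_iff, mem_coe, mem_filter, hZ, mem_univ, true_and,
        ext_cons] at h h' heq
      have hz : ∀ (Q : Equiv.Perm α) (w : α), Q u = v → w ≠ u → sw Q w v u = w := by
        intro Q w hQ hw
        rw [sw_apply, Equiv.swap_apply_of_ne_of_ne (Ne.symm hw) huv, hQ, Equiv.swap_apply_right]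
      have hzz : z = z' := by
        rw [← hz P z h.1.2.1 h.2.1, heq, hz P' z' h'.1.2.1 h'.2.1]
      subst hzz
      have : P = P' := by rw [← sw_sw P z v, heq, sw_sw]
      rw [this]
  rw [card_sigma] at key
  refine le_trans ?_ key
  rw [← smul_eq_mul]
  exact card_nsmul_le_sum _ _ _ hcard

lemma card_ext_mul_pow_le {F : Finset (Equiv.Perm α)} {b D m : ℕ}
    (hb : NearlyClosed F b) (hD : D + 2 * m + b ≤ Fintype.card α) {L : List (α × α)}
    (hL : Valid L) (hm : L.length ≤ m) :
    (F.filter fun P => Ext P L).card * D ^ L.length ≤ F.card := by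
  induction L with
  | nil => simpa using card_filter_le F _
  | cons e L ih =>
    have hm' : L.length + 1 ≤ m := hm
    have h1 := card_ext_cons_le hb hL
    have h2 := ih hL.2.2.2 (by omega)
    have h3 : D ≤ Fintype.card α - (2 * L.length + 1 + b) := by omega
    calc _ = (F.filter fun P => Ext P (e :: L)).card * D * D ^ L.length := by
          rw [List.length_cons, pow_succ]; ring
      _ ≤ (F.filter fun P => Ext P L).card * D ^ L.length := by
          gcongr
          exact le_trans (Nat.mul_le_mul_left _ h3) h1
      _ ≤ _ := h2

/-- The perfect matching obtained from `P` by switching in the edges of the list one by one. -/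
def force (P : Equiv.Perm α) : List (α × α) → Equiv.Perm α
  | [] => P
  | e :: L => sw (force P L) (force P L e.1) e.2

lemma IsPM.force {P : Equiv.Perm α} (h : IsPM P) (L : List (α × α)) : IsPM (force P L) := by
  induction L with
  | nil => exact h
  | cons e L ih => exact ih.sw _ _

/-- To insert `uv`, the current partner of `u` trades places with `v`. Neither lies on the edges of
`L` already inserted, because those vertices are matched among themselves. -/
lemma ext_force {P : Equiv.Perm α} (h : IsPM P) {L : List (α × α)} (hL : Valid L) :
    Ext (force P L) L := by
  induction L with
  | nil => simp [Ext]
  | cons e L ih =>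
    obtain ⟨u, v⟩ := e
    obtain ⟨huv, huL, hvL, hL'⟩ := hL
    simp only at huv huL hvL
    have hQ := h.force L
    have ih := ih hL'
    rw [ext_cons]
    simp only [force]
    refine ⟨?_, fun e he => ?_⟩
    · rw [sw_apply, Equiv.swap_apply_of_ne_of_ne (hQ.2 u).symm huv, Equiv.swap_apply_left]
    · have e1 : e.1 ∈ verts L := mem_verts.2 ⟨e, he, Or.inl rfl⟩
      have e2 : e.2 ∈ verts L := mem_verts.2 ⟨e, he, Or.inr rfl⟩
      have h3 : force P L u ∉ verts L := fun hh => by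
        have := ih.apply_mem hQ hh
        rw [hQ.1] at this
        exact huL this
      rw [sw_apply, Equiv.swap_apply_of_ne_of_ne (x := e.1), ih e he, Equiv.swap_apply_of_ne_of_ne] <;>
        (rintro hh; simp_all)

lemma force_apply_of_notMem {P : Equiv.Perm α} (h : IsPM P) {L : List (α × α)} {w : α}
    (h1 : w ∉ verts L) (h2 : P w ∉ verts L) : force P L w = P w := by
  induction L with
  | nil => rfl
  | cons e L ih =>
    obtain ⟨u, v⟩ := e
    simp only [verts, mem_insert, not_or] at h1 h2
    have ih := ih h1.2.2 h2.2.2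
    have hQ := h.force L
    simp only [force]
    rw [sw_apply, Equiv.swap_apply_of_ne_of_ne _ h1.2.1, ih,
      Equiv.swap_apply_of_ne_of_ne _ h2.2.1]
    · rw [← ih]
      exact fun hh => h1.1 ((force P L).injective hh)
    · intro hh
      apply h2.1
      rw [← ih, hh, hQ.1]

/-- Each inserted edge `uv` is undone by remembering the former partner of `u`, so every step is at
most `Fintype.card α` to one. -/
lemma card_le_of_force_mem {A B : Finset (Equiv.Perm α)}
    {L : List (α × α)} (hL : Valid L) (h : ∀ P ∈ A, force P L ∈ B) :
    A.card ≤ B.card * Fintype.card α ^ L.length := by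
  induction L generalizing B with
  | nil => simpa using card_le_card fun P hP => h P hP
  | cons e L ih =>
    obtain ⟨u, v⟩ := e
    obtain ⟨huv, huL, hvL, hL'⟩ := hL
    have h1 := ih (B := A.image fun P => force P L) hL' (fun P hP => mem_image_of_mem _ hP)
    have h2 : (A.image fun P => force P L).card ≤ B.card * Fintype.card α := by
      rw [← card_univ, ← card_product]
      refine card_le_card_of_injOn (fun Q => (sw Q (Q u) v, Q u)) ?_ ?_
      · intro Q hQ
        simp only [coe_image, Set.mem_image, mem_coe] at hQ
        obtain ⟨P, hP, rfl⟩ := hQ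
        simpa [force] using h P hP
      · intro Q _ Q' _ heq
        simp only [Prod.mk.injEq] at heq
        rw [← sw_sw Q (Q u) v, heq.1, heq.2, sw_sw]
    calc A.card ≤ _ := h1
      _ ≤ (B.card * Fintype.card α) * Fintype.card α ^ L.length := Nat.mul_le_mul_right _ h2
      _ = _ := by rw [List.length_cons, pow_succ]; ring

end PerfectMatchings

/-! ### Rarity of short paths with prescribed ends -/

section Gaps

variable {α β : Type*} [Fintype α] [DecidableEq α] [DecidableEq β]

/-- There is a path that starts at the class of `x`, uses `j` edges of `P` and then an edge of `P`
with end `τ`, and does not visit the elements of `U`. -/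
def Gap (c : α → β) (P : Equiv.Perm α) (τ : α) : ℕ → Finset α → α → Prop
  | 0, U, x => ∃ t, c t = c x ∧ t ∉ U ∧ P t = τ
  | j + 1, U, x => ∃ o, c o = c x ∧ o ∉ U ∧ Gap c P τ j (insert o (insert (P o) U)) (P o)

noncomputable instance (c : α → β) (P : Equiv.Perm α) (τ : α) (j : ℕ) (U : Finset α) (x : α) :
    Decidable (Gap c P τ j U x) := Classical.dec _

lemma sum_card_ext_cons_le (F : Finset (Equiv.Perm α)) (L : List (α × α)) (o : α) (Y : Finset α) :
    ∑ y ∈ Y, (F.filter fun P => Ext P ((o, y) :: L)).card ≤ (F.filter fun P => Ext P L).card := by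
  rw [← card_biUnion]
  · refine card_le_card fun P hP => ?_
    simp only [mem_biUnion, mem_filter, ext_cons] at hP ⊢
    tauto
  · intro y _ y' _ hyy
    rw [Function.onFun, disjoint_left]
    intro P h1 h2
    simp only [mem_filter, ext_cons] at h1 h2
    exact hyy (h1.2.1.symm.trans h2.2.1)

/-- Expose the path edge by edge. Each of the `j + 1` edges leaves its class in at most `d` ways.
The partners of the first `j` exits are free, and summing over them costs nothing because these
events are disjoint. Only the last edge has a prescribed end, which gains the factor `1 / D`. -/
lemma card_gap_le {c : α → β} {d : ℕ} (hd : ∀ x, (univ.filter fun y => c y = c x).card ≤ d)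
    {F : Finset (Equiv.Perm α)} (hF : F ⊆ perfectMatchings α) {b D m : ℕ}
    (hb : NearlyClosed F b) (hD : D + 2 * m + b ≤ Fintype.card α) (τ : α) (j : ℕ)
    {L : List (α × α)} (hL : Valid L) (hm : L.length + j + 1 ≤ m) (x : α) :
    (F.filter fun P => Ext P L ∧ Gap c P τ j (verts L) x).card * D ≤
      d ^ (j + 1) * (F.filter fun P => Ext P L).card := by
  induction j generalizing L x with
  | zero =>
    have h1 : (F.filter fun P => Ext P L ∧ Gap c P τ 0 (verts L) x) ⊆
        (univ.filter fun y => c y = c x).biUnion fun t =>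
          if t ∉ verts L ∧ τ ∉ verts L ∧ t ≠ τ then
            F.filter fun P => Ext P ((t, τ) :: L) else ∅ := by
      intro P hP
      rw [mem_filter] at hP
      obtain ⟨hPF, hPL, t, htx, htL, htτ⟩ := hP
      have hPM := mem_perfectMatchings.1 (hF hPF)
      have hτ : τ ∉ verts L := fun h => htL <| by
        have := hPL.apply_mem hPM h
        rwa [hPM.eq_symm htτ] at this
      have htτ' : t ≠ τ := fun h => hPM.2 t (htτ.trans h.symm)
      rw [mem_biUnion]
      refine ⟨t, by simpa using htx, ?_⟩
      rw [if_pos ⟨htL, hτ, htτ'⟩, mem_filter, ext_cons]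
      exact ⟨hPF, htτ, hPL⟩
    have h2 := (card_le_card h1).trans card_biUnion_le
    have h3 : ∀ t, (if t ∉ verts L ∧ τ ∉ verts L ∧ t ≠ τ then
            F.filter fun P => Ext P ((t, τ) :: L) else ∅).card * D ≤
            (F.filter fun P => Ext P L).card := by
      intro t
      split_ifs with h
      · have h4 := card_ext_cons_le hb (e := (t, τ)) (L := L) ⟨h.2.2, h.1, h.2.1, hL⟩
        refine le_trans (Nat.mul_le_mul_left _ ?_) h4
        omega
      · simp
    calc _ ≤ (∑ t ∈ univ.filter fun y => c y = c x, (if t ∉ verts L ∧ τ ∉ verts L ∧ t ≠ τ then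
            F.filter fun P => Ext P ((t, τ) :: L) else ∅).card) * D := Nat.mul_le_mul_right _ h2
      _ ≤ ∑ t ∈ univ.filter fun y => c y = c x, (F.filter fun P => Ext P L).card := by
          rw [sum_mul]
          exact sum_le_sum fun t _ => h3 t
      _ ≤ d ^ (0 + 1) * (F.filter fun P => Ext P L).card := by
          rw [sum_const, smul_eq_mul, zero_add, pow_one]
          exact Nat.mul_le_mul_right _ (hd x)
  | succ j ih =>
    have h1 : (F.filter fun P => Ext P L ∧ Gap c P τ (j + 1) (verts L) x) ⊆
        (univ.filter fun y => c y = c x).biUnion fun o => univ.biUnion fun y =>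
          if o ≠ y ∧ o ∉ verts L ∧ y ∉ verts L then
            F.filter fun P => Ext P ((o, y) :: L) ∧ Gap c P τ j (verts ((o, y) :: L)) y else ∅ := by
      intro P hP
      rw [mem_filter] at hP
      obtain ⟨hPF, hPL, o, hox, hoL, hgap⟩ := hP
      have hPM := mem_perfectMatchings.1 (hF hPF)
      have hPo : P o ∉ verts L := fun h => hoL <| by
        have := hPL.apply_mem hPM h
        rwa [hPM.1] at this
      rw [mem_biUnion]
      refine ⟨o, by simpa using hox, ?_⟩
      rw [mem_biUnion]
      refine ⟨P o, mem_univ _, ?_⟩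
      rw [if_pos ⟨(hPM.2 o).symm, hoL, hPo⟩, mem_filter, ext_cons]
      exact ⟨hPF, ⟨rfl, hPL⟩, hgap⟩
    have h3 : ∀ o y, (if o ≠ y ∧ o ∉ verts L ∧ y ∉ verts L then
            F.filter fun P => Ext P ((o, y) :: L) ∧
              Gap c P τ j (verts ((o, y) :: L)) y else ∅).card * D ≤
            d ^ (j + 1) * (F.filter fun P => Ext P ((o, y) :: L)).card := by
      intro o y
      split_ifs with h
      · exact ih (L := (o, y) :: L) ⟨h.1, h.2.1, h.2.2, hL⟩ (by simp only [List.length_cons]; omega) y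
      · simp
    have h2 := (card_le_card h1).trans (card_biUnion_le.trans
      (sum_le_sum fun o _ => card_biUnion_le))
    refine (Nat.mul_le_mul_right D h2).trans ?_
    rw [sum_mul]
    calc _ ≤ ∑ o ∈ univ.filter fun y => c y = c x,
          d ^ (j + 1) * (F.filter fun P => Ext P L).card := by
          refine sum_le_sum fun o _ => ?_
          rw [sum_mul]
          refine (sum_le_sum fun y _ => h3 o y).trans ?_
          rw [← mul_sum]
          exact Nat.mul_le_mul_left _ (sum_card_ext_cons_le F L o univ)
      _ ≤ _ := by
          rw [sum_const, smul_eq_mul, pow_succ d (j + 1), mul_comm _ d, mul_assoc]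
          exact Nat.mul_le_mul_right _ (hd x)

/-- The elements reached by paths that start at the class of `x`, use `j` edges of `P`, and end
with a step inside a class. -/
def reach (c : α → β) (P : Equiv.Perm α) (x : α) : ℕ → Finset α
  | 0 => univ.filter fun y => c y = c x
  | j + 1 => (reach c P x j).biUnion fun w => univ.filter fun y => c y = c (P w)

lemma card_reach_le {c : α → β} {d : ℕ} (hd : ∀ x, (univ.filter fun y => c y = c x).card ≤ d)
    (P : Equiv.Perm α) (x : α) (j : ℕ) : (reach c P x j).card ≤ d ^ (j + 1) := by
  induction j with
  | zero => simpa [reach] using hd x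
  | succ j ih =>
    refine card_biUnion_le.trans ((sum_le_sum fun w _ => hd (P w)).trans ?_)
    rw [sum_const, smul_eq_mul, pow_succ]
    exact Nat.mul_le_mul_right _ ih

end Gaps

/-! ### Cycles as cyclic sequences, and their edge sets -/

section Cycles

variable {α β : Type*} [Fintype α] [DecidableEq α] [DecidableEq β]

/-- A sequence of pairs of elements of pairwise distinct classes. It stands for a cycle of length
`k` through these classes, which enters the `i`th class at `(s i).1` and leaves it at
`(s i).2`. -/
structure IsCyc (c : α → β) {k : ℕ} (s : ZMod k → α × α) : Prop where
  same : ∀ i, c (s i).1 = c (s i).2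
  ne : ∀ i, (s i).1 ≠ (s i).2
  inj : Function.Injective fun i => c (s i).1

/-- The set of edges of a cycle. -/
def cycEdges {k : ℕ} [NeZero k] (s : ZMod k → α × α) : Finset (Sym2 α) :=
  univ.image fun i => s((s i).2, (s (i + 1)).1)

/-- The perfect matching `P` contains the cycle `s`. -/
def Follows {k : ℕ} (P : Equiv.Perm α) (s : ZMod k → α × α) : Prop :=
  ∀ i, P (s i).2 = (s (i + 1)).1

/-- The perfect matching `P` contains the edges in `M`. -/
def Contains (P : Equiv.Perm α) (M : Finset (Sym2 α)) : Prop := ∀ x y, s(x, y) ∈ M → P x = y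

noncomputable instance (P : Equiv.Perm α) (M : Finset (Sym2 α)) : Decidable (Contains P M) :=
  Classical.dec _

noncomputable instance (c : α → β) {k : ℕ} (s : ZMod k → α × α) : Decidable (IsCyc c s) :=
  Classical.dec _

/-- The edge sets of all cycles of length `k`. -/
noncomputable def cycles (c : α → β) (k : ℕ) [NeZero k] : Finset (Finset (Sym2 α)) :=
  (univ.filter fun s : ZMod k → α × α => IsCyc c s).image cycEdges

variable {c : α → β} {k : ℕ} [NeZero k]

lemma mem_cycles {M : Finset (Sym2 α)} :
    M ∈ cycles c k ↔ ∃ s : ZMod k → α × α, IsCyc c s ∧ cycEdges s = M := by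
  simp [cycles]

lemma mem_cycEdges {s : ZMod k → α × α} {e : Sym2 α} :
    e ∈ cycEdges s ↔ ∃ i, s((s i).2, (s (i + 1)).1) = e := by
  simp [cycEdges]

lemma contains_cycEdges {P : Equiv.Perm α} (hP : IsPM P) {s : ZMod k → α × α} :
    Contains P (cycEdges s) ↔ Follows P s := by
  constructor
  · intro h i
    exact h _ _ (mem_cycEdges.2 ⟨i, rfl⟩)
  · intro h x y hxy
    obtain ⟨i, hi⟩ := mem_cycEdges.1 hxy
    rw [Sym2.eq_iff] at hi
    rcases hi with ⟨rfl, rfl⟩ | ⟨rfl, rfl⟩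
    · exact h i
    · exact hP.eq_symm (h i)

/-- The same cycle with another starting point. -/
def rotateCyc {k : ℕ} (s : ZMod k → α × α) (m : ZMod k) : ZMod k → α × α := fun i => s (i + m)

/-- The same cycle in the opposite direction. -/
def reverseCyc {k : ℕ} (s : ZMod k → α × α) : ZMod k → α × α := fun i => (s (-i)).swap

lemma IsCyc.rotate {s : ZMod k → α × α} (h : IsCyc c s) (m : ZMod k) :
    IsCyc c (rotateCyc s m) :=
  ⟨fun i => h.same _, fun i => h.ne _, fun i j hij => by simpa using h.inj hij⟩

lemma IsCyc.reverse {s : ZMod k → α × α} (h : IsCyc c s) : IsCyc c (reverseCyc s) := by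
  refine ⟨fun i => (h.same _).symm, fun i => (h.ne _).symm, fun i j hij => ?_⟩
  have h1 : c (s (-i)).2 = c (s (-j)).2 := hij
  rw [← h.same, ← h.same] at h1
  simpa using h.inj h1

lemma cycEdges_rotate (s : ZMod k → α × α) (m : ZMod k) :
    cycEdges (rotateCyc s m) = cycEdges s := by
  ext e
  simp only [mem_cycEdges, rotateCyc]
  constructor
  · rintro ⟨i, rfl⟩
    exact ⟨i + m, by rw [add_right_comm]⟩
  · rintro ⟨i, rfl⟩
    exact ⟨i - m, by rw [add_right_comm]; simp⟩

lemma cycEdges_reverse (s : ZMod k → α × α) : cycEdges (reverseCyc s) = cycEdges s := by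
  ext e
  simp only [mem_cycEdges, reverseCyc, Prod.snd_swap, Prod.fst_swap]
  constructor
  · rintro ⟨i, rfl⟩
    exact ⟨-(i + 1), by rw [Sym2.eq_swap]; congr 4; ring⟩
  · rintro ⟨i, rfl⟩
    exact ⟨-(i + 1), by rw [Sym2.eq_swap]; congr 4 <;> ring⟩

lemma Follows.rotate {P : Equiv.Perm α} {s : ZMod k → α × α} (h : Follows P s) (m : ZMod k) :
    Follows P (rotateCyc s m) := fun i => by
  have := h (i + m)
  rwa [add_right_comm] at this

lemma IsCyc.eq_of_class {s : ZMod k → α × α} (h : IsCyc c s) {i j : ZMod k}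
    (hij : c (s i).1 = c (s j).1) : i = j := h.inj hij

lemma IsCyc.snd_eq_of_mem {s : ZMod k → α × α} (h : IsCyc c s) {l : ZMod k} {y : α}
    (hy : s((s l).2, y) ∈ cycEdges s) : y = (s (l + 1)).1 := by
  obtain ⟨i, hi⟩ := mem_cycEdges.1 hy
  rw [Sym2.eq_iff] at hi
  rcases hi with ⟨h1, rfl⟩ | ⟨h1, h2⟩
  · have : i = l := h.inj (by
      change c (s i).1 = c (s l).1
      rw [h.same, h1, h.same])
    rw [this]
  · have : i + 1 = l := h.inj (by
      change c (s (i + 1)).1 = c (s l).1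
      rw [h2, h.same])
    rw [this] at h2
    exact absurd h2 (h.ne l)

/-- The elements of a cycle. -/
def cycVerts (s : ZMod k → α × α) : Finset α :=
  univ.biUnion fun i => {(s i).1, (s i).2}

lemma mem_cycVerts {s : ZMod k → α × α} {x : α} :
    x ∈ cycVerts s ↔ ∃ i, x = (s i).1 ∨ x = (s i).2 := by
  simp [cycVerts]

lemma mem_cycVerts_of_mem_cycEdges {s : ZMod k → α × α} {x y : α} (h : s(x, y) ∈ cycEdges s) :
    x ∈ cycVerts s := by
  obtain ⟨i, hi⟩ := mem_cycEdges.1 h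
  rw [Sym2.eq_iff] at hi
  rw [mem_cycVerts]
  rcases hi with ⟨h1, -⟩ | ⟨-, h1⟩
  · exact ⟨i, Or.inr h1.symm⟩
  · exact ⟨i + 1, Or.inl h1.symm⟩

lemma IsCyc.snd_eq_of_class {s : ZMod k → α × α} (h : IsCyc c s) {l : ZMod k} {x : α}
    (hx : x ∈ cycVerts s) (hc : c (s l).1 = c x) (hne : (s l).1 ≠ x) : x = (s l).2 := by
  obtain ⟨i, rfl | rfl⟩ := mem_cycVerts.1 hx
  · exact absurd (by rw [h.eq_of_class hc]) hne
  · rw [← h.same] at hc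
    rw [h.eq_of_class hc]

/-- The cycle `m` has only two elements in each of its classes, so the entrance determines the exit,
and the exit determines the next entrance. Thus `s` is forced to run along `m`. -/
lemma IsCyc.eq_rotate_of_subset {r : ℕ} [NeZero r] {s : ZMod r → α × α} {m : ZMod k → α × α}
    (hs : IsCyc c s) (hm : IsCyc c m) (hsub : cycEdges s ⊆ cycEdges m) {l : ZMod k}
    (h0 : (s 0).1 = (m l).1) (i : ℕ) : s (i : ZMod r) = m (l + i) := by
  have key : ∀ (i : ZMod r) (l : ZMod k), (s i).1 = (m l).1 → (s i).2 = (m l).2 := by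
    intro i l h
    refine hm.snd_eq_of_class (mem_cycVerts_of_mem_cycEdges (hsub (mem_cycEdges.2 ⟨i, rfl⟩))) ?_ ?_
    · rw [← h, hs.same]
    · rw [← h]; exact hs.ne i
  have h1 : (s (i : ZMod r)).1 = (m (l + i)).1 := by
    induction i with
    | zero => simpa using h0
    | succ i ih =>
      have h2 := key _ _ ih
      have h3 : s((s (i : ZMod r)).2, (s ((i : ZMod r) + 1)).1) ∈ cycEdges m :=
        hsub (mem_cycEdges.2 ⟨_, rfl⟩)
      rw [h2] at h3
      push_cast
      rw [hm.snd_eq_of_mem h3, add_assoc]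
  exact Prod.ext h1 (key _ _ h1)

lemma IsCyc.exists_fst_eq {r : ℕ} [NeZero r] {s : ZMod r → α × α} {m : ZMod k → α × α}
    (hm : IsCyc c m) (hsub : cycEdges s ⊆ cycEdges m) :
    ∃ m' : ZMod k → α × α, IsCyc c m' ∧ cycEdges m' = cycEdges m ∧ ∃ l, (s 0).1 = (m' l).1 := by
  have h0 : (s 0).1 ∈ cycVerts m := by
    have : s((s (-1)).2, (s (-1 + 1)).1) ∈ cycEdges m := hsub (mem_cycEdges.2 ⟨_, rfl⟩)
    rw [neg_add_cancel, Sym2.eq_swap] at this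
    exact mem_cycVerts_of_mem_cycEdges this
  obtain ⟨l, hl | hl⟩ := mem_cycVerts.1 h0
  · exact ⟨m, hm, rfl, l, hl⟩
  · exact ⟨reverseCyc m, hm.reverse, cycEdges_reverse m, -l, by simpa [reverseCyc] using hl⟩

/-- After `r` steps `s` is back at its start while having moved `r` places along `m`, so `k` divides
`r`. -/
lemma IsCyc.le_of_subset {r : ℕ} [NeZero r] {s : ZMod r → α × α} {m : ZMod k → α × α}
    (hs : IsCyc c s) (hm : IsCyc c m) (hsub : cycEdges s ⊆ cycEdges m) : k ≤ r := by
  obtain ⟨m', hm', he, l, hl⟩ := hm.exists_fst_eq hsub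
  have h1 := hs.eq_rotate_of_subset hm' (he ▸ hsub) hl r
  rw [ZMod.natCast_self] at h1
  have h2 : l = l + (r : ZMod k) := hm'.inj (by
    change c (m' l).1 = c (m' _).1
    rw [← hl, h1])
  have h3 : (r : ZMod k) = 0 := by simpa using h2.symm
  rw [ZMod.natCast_eq_zero_iff] at h3
  exact Nat.le_of_dvd (Nat.pos_of_ne_zero (NeZero.ne r)) h3

lemma IsCyc.cycEdges_eq_of_subset {s m : ZMod k → α × α}
    (hs : IsCyc c s) (hm : IsCyc c m) (hsub : cycEdges s ⊆ cycEdges m) :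
    cycEdges s = cycEdges m := by
  obtain ⟨m', hm', he, l, hl⟩ := hm.exists_fst_eq hsub
  have h1 : s = rotateCyc m' l := by
    funext i
    have := hs.eq_rotate_of_subset hm' (he ▸ hsub) hl i.val
    rw [ZMod.natCast_zmod_val] at this
    rw [this, rotateCyc, add_comm]
  rw [h1, cycEdges_rotate, he]

lemma IsCyc.eq_of_cycEdges_eq {s m : ZMod k → α × α} (hs : IsCyc c s) (hm : IsCyc c m)
    (he : cycEdges s = cycEdges m) (h0 : (s 0).1 = (m 0).1) : s = m := by
  funext i
  have := hs.eq_rotate_of_subset hm he.subset h0 i.val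
  rwa [ZMod.natCast_zmod_val, zero_add] at this

lemma IsCyc.card_cycVerts {s : ZMod k → α × α} (hs : IsCyc c s) : (cycVerts s).card = 2 * k := by
  rw [cycVerts, card_biUnion]
  · simp_rw [card_pair (hs.ne _)]
    simp [ZMod.card, mul_comm]
  · intro i _ j _ hij
    rw [Function.onFun, disjoint_left]
    intro x hx hy
    simp only [mem_insert, mem_singleton] at hx hy
    apply hij
    apply hs.eq_of_class
    rcases hx with rfl | rfl <;> rcases hy with h | h
    · rw [h]
    · rw [h, hs.same]
    · rw [hs.same, h]
    · rw [hs.same, h, hs.same]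

/-- A sequence with this edge set is determined by its first entrance, which can be any of the `2k`
elements of the cycle (rotate, after reversing if necessary). Counting elements instead of
symmetries treats loops and double edges uniformly. -/
lemma IsCyc.card_fiber {m : ZMod k → α × α} (hm : IsCyc c m) :
    (univ.filter fun s : ZMod k → α × α => IsCyc c s ∧ cycEdges s = cycEdges m).card = 2 * k := by
  rw [← hm.card_cycVerts]
  refine card_bij (fun s _ => (s 0).1) ?_ ?_ ?_
  · intro s hs
    rw [mem_filter] at hs
    have : s((s (-1)).2, (s (-1 + 1)).1) ∈ cycEdges m := hs.2.2 ▸ (mem_cycEdges.2 ⟨_, rfl⟩)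
    rw [neg_add_cancel, Sym2.eq_swap] at this
    exact mem_cycVerts_of_mem_cycEdges this
  · intro s hs s' hs' h
    rw [mem_filter] at hs hs'
    exact hs.2.1.eq_of_cycEdges_eq hs'.2.1 (hs.2.2.trans hs'.2.2.symm) h
  · intro x hx
    obtain ⟨l, hl | hl⟩ := mem_cycVerts.1 hx
    · refine ⟨rotateCyc m l, ?_, ?_⟩
      · simpa using ⟨hm.rotate l, cycEdges_rotate m l⟩
      · simp [rotateCyc, hl]
    · refine ⟨rotateCyc (reverseCyc m) (-l), ?_, ?_⟩
      · simpa using ⟨hm.reverse.rotate _, (cycEdges_rotate _ _).trans (cycEdges_reverse m)⟩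
      · simp [rotateCyc, reverseCyc, hl]

lemma card_cycles_mul (c : α → β) (k : ℕ) [NeZero k] :
    (cycles c k).card * (2 * k) = (univ.filter fun s : ZMod k → α × α => IsCyc c s).card := by
  rw [card_eq_sum_card_image cycEdges]
  rw [← smul_eq_mul, ← sum_const]
  refine sum_congr rfl fun M hM => ?_
  obtain ⟨m, hm, rfl⟩ := mem_cycles.1 hM
  rw [filter_filter, hm.card_fiber]

end Cycles

/-! ### Paths of a matching, and the paths left inside a cycle by a switching -/

section Paths

variable {α β : Type*} [Fintype α] [DecidableEq α] [DecidableEq β] {c : α → β}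

/-- A path with `j` edges of `P`, which enters its `i`th class at `a i` and leaves it at `b i`. -/
structure IsPath (c : α → β) (P : Equiv.Perm α) (j : ℕ) (a b : ℕ → α) : Prop where
  same : ∀ i ≤ j, c (a i) = c (b i)
  ne : ∀ i ≤ j, a i ≠ b i
  inj : ∀ i ≤ j, ∀ i' ≤ j, c (a i) = c (a i') → i = i'
  link : ∀ i < j, P (b i) = a (i + 1)

lemma IsPath.reverse {P : Equiv.Perm α} (hP : IsPM P) {j : ℕ} {a b : ℕ → α}
    (h : IsPath c P j a b) : IsPath c P j (fun i => b (j - i)) (fun i => a (j - i)) := by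
  refine ⟨fun i hi => (h.same _ (by omega)).symm, fun i hi => (h.ne _ (by omega)).symm,
    fun i hi i' hi' hc => ?_, fun i hi => ?_⟩
  · rw [← h.same _ (by omega), ← h.same _ (by omega)] at hc
    have := h.inj _ (by omega) _ (by omega) hc
    omega
  · have := h.link (j - (i + 1)) (by omega)
    rw [show j - (i + 1) + 1 = j - i by omega] at this
    exact hP.eq_symm this

lemma IsPath.tail {P : Equiv.Perm α} {j : ℕ} {a b : ℕ → α} (h : IsPath c P (j + 1) a b) :
    IsPath c P j (fun i => a (i + 1)) (fun i => b (i + 1)) := by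
  refine ⟨fun i hi => h.same _ (by omega), fun i hi => h.ne _ (by omega),
    fun i hi i' hi' hc => ?_, fun i hi => h.link _ (by omega)⟩
  have := h.inj _ (by omega) _ (by omega) hc
  omega

lemma IsPath.init {P : Equiv.Perm α} {j : ℕ} {a b : ℕ → α} (h : IsPath c P (j + 1) a b) :
    IsPath c P j a b :=
  ⟨fun i hi => h.same _ (by omega), fun i hi => h.ne _ (by omega),
    fun i hi i' hi' hc => h.inj _ (by omega) _ (by omega) hc, fun i hi => h.link _ (by omega)⟩

lemma IsPath.mem_reach {P : Equiv.Perm α} {j : ℕ} {a b : ℕ → α} (h : IsPath c P j a b) :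
    b j ∈ reach c P (a 0) j := by
  induction j with
  | zero => simpa [reach] using (h.same 0 le_rfl).symm
  | succ j ih =>
    simp only [reach, mem_biUnion, mem_filter, mem_univ, true_and]
    refine ⟨b j, ih h.init, ?_⟩
    rw [h.link j (by omega), h.same _ le_rfl]

lemma IsPath.gap {P : Equiv.Perm α} {j : ℕ} {a b : ℕ → α} (h : IsPath c P j a b) {τ : α}
    (hτ : P (b j) = τ) {U : Finset α} (hU : ∀ i ≤ j, b i ∉ U) : Gap c P τ j U (a 0) := by
  induction j generalizing a b U with
  | zero => exact ⟨b 0, (h.same 0 le_rfl).symm, hU 0 le_rfl, hτ⟩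
  | succ j ih =>
    refine ⟨b 0, (h.same 0 (by omega)).symm, hU 0 (by omega), ?_⟩
    rw [h.link 0 (by omega)]
    refine ih h.tail hτ fun i hi => ?_
    simp only [mem_insert, not_or]
    refine ⟨fun hh => ?_, fun hh => ?_, hU _ (by omega)⟩
    · have := h.inj (i + 1) (by omega) 0 (by omega)
        (by rw [h.same _ (by omega), h.same _ (by omega), hh])
      omega
    · have := h.inj (i + 1) (by omega) 1 (by omega) (by rw [h.same _ (by omega), hh])
      have hi0 : i = 0 := by omega
      subst hi0
      exact h.ne 1 (by omega) hh.symm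

lemma IsPath.close {P : Equiv.Perm α} {j : ℕ} {a b : ℕ → α} (h : IsPath c P j a b)
    (h0 : P (b j) = a 0) : ∃ s : ZMod (j + 1) → α × α, IsCyc c s ∧ Follows P s := by
  have hval : ∀ i : ZMod (j + 1), i.val ≤ j := fun i => Nat.lt_succ_iff.1 (ZMod.val_lt i)
  refine ⟨fun i => (a i.val, b i.val), ⟨fun i => h.same _ (hval i), fun i => h.ne _ (hval i),
    fun i i' hc => ZMod.val_injective _ (h.inj _ (hval i) _ (hval i') hc)⟩, fun i => ?_⟩
  simp only
  rcases (hval i).lt_or_eq with hi | hi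
  · rw [h.link _ hi]
    congr 1
    have : (i + 1).val = i.val + 1 := by
      rw [← ZMod.natCast_zmod_val i, ← Nat.cast_add_one, ZMod.val_natCast, ZMod.val_natCast,
        Nat.mod_eq_of_lt (by omega), Nat.mod_eq_of_lt (by omega)]
    rw [this]
  · have : i + 1 = 0 := by
      rw [← ZMod.natCast_zmod_val i, hi, ← Nat.cast_add_one, ZMod.natCast_self]
    rw [this, ZMod.val_zero, hi, h0]

/-- If `s` is a cycle of `Q` whose last edge is special, then the first special edge of `s` is the
end of a path of `P`, where `P` and `Q` agree outside of the special elements. -/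
lemma IsCyc.exists_path {r : ℕ} [NeZero r] {s : ZMod r → α × α} (hs : IsCyc c s)
    {P Q : Equiv.Perm α} (hQ : Follows Q s) {Sp : α → Prop} (hPQ : ∀ w, ¬ Sp w → Q w = P w)
    (h0 : Sp (s (-1)).2) :
    ∃ j < r, Sp (s (j : ZMod r)).2 ∧ (∀ i < j, ¬ Sp (s (i : ZMod r)).2) ∧
      IsPath c P j (fun i => (s (i : ZMod r)).1) (fun i => (s (i : ZMod r)).2) := by
  classical
  have hr : 0 < r := Nat.pos_of_ne_zero (NeZero.ne r)
  have hlast : (((r - 1 : ℕ) : ℕ) : ZMod r) = -1 := by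
    rw [Nat.cast_sub hr]; simp
  have hex : ∃ j : ℕ, Sp (s (j : ZMod r)).2 := ⟨r - 1, by rwa [hlast]⟩
  have hlt : Nat.find hex < r := by
    have := Nat.find_min' hex (m := r - 1) (by rwa [hlast])
    omega
  refine ⟨Nat.find hex, hlt, Nat.find_spec hex, fun i hi => Nat.find_min hex hi,
    fun i _ => hs.same _, fun i _ => hs.ne _, fun i hi i' hi' hc => ?_, fun i hi => ?_⟩
  · have := (ZMod.natCast_eq_natCast_iff' _ _ _).1 (hs.eq_of_class hc)
    rwa [Nat.mod_eq_of_lt (by omega), Nat.mod_eq_of_lt (by omega)] at this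
  · rw [← hPQ _ (Nat.find_min hex hi), hQ, Nat.cast_add_one]

end Paths

/-! ### Matchings avoiding cycles are nearly closed under switchings -/

section Avoid

variable {α β : Type*} [Fintype α] [DecidableEq α] [DecidableEq β] {c : α → β}
  {k : ℕ} [NeZero k]

noncomputable instance (c : α → β) (k : ℕ) (P : Equiv.Perm α) : Decidable
    (∀ j, j + 1 < k → ∀ M ∈ cycles c (j + 1), ¬ Contains P M) := Classical.dec _

/-- The perfect matchings without cycles of length less than `k` that contain no member
of `T`. -/
noncomputable def avoid (c : α → β) (k : ℕ) (T : Finset (Finset (Sym2 α))) :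
    Finset (Equiv.Perm α) :=
  (perfectMatchings α).filter fun P =>
    (∀ j, j + 1 < k → ∀ M ∈ cycles c (j + 1), ¬ Contains P M) ∧ ∀ M ∈ T, ¬ Contains P M

lemma avoid_subset {T : Finset (Finset (Sym2 α))} : avoid c k T ⊆ perfectMatchings α :=
  filter_subset _ _

lemma not_follows_of_lt {T : Finset (Finset (Sym2 α))} {P : Equiv.Perm α} (hP : P ∈ avoid c k T)
    {r : ℕ} [NeZero r] (hr : r < k) {s : ZMod r → α × α} (hs : IsCyc c s) : ¬ Follows P s := by
  rw [avoid, mem_filter, mem_perfectMatchings] at hP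
  obtain _ | j := r
  · exact absurd rfl (NeZero.ne 0)
  · rw [← contains_cycEdges hP.1]
    exact hP.2.1 j hr _ (mem_cycles.2 ⟨s, hs, rfl⟩)

/-- The witness is a cycle shorter than `k` or a member of `T`. Neither lies inside a `k`-cycle
outside `T`: a cycle contains no shorter cycle, and two nested cycles of equal length coincide. -/
lemma exists_cyc_of_notMem_avoid {T : Finset (Finset (Sym2 α))} (hT : T ⊆ cycles c k)
    {Q : Equiv.Perm α} (hQ : IsPM Q) (h : Q ∉ avoid c k T) :
    ∃ (r : ℕ) (_ : NeZero r) (s : ZMod r → α × α), r ≤ k ∧ IsCyc c s ∧ Follows Q s ∧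
      (∀ P ∈ avoid c k T, ¬ Follows P s) ∧
      ∀ m : ZMod k → α × α, IsCyc c m → cycEdges m ∉ T → ¬ cycEdges s ⊆ cycEdges m := by
  have h' : ¬ ((∀ j, j + 1 < k → ∀ M ∈ cycles c (j + 1), ¬ Contains Q M) ∧
      ∀ M ∈ T, ¬ Contains Q M) := fun hh => h <| by
    rw [avoid, mem_filter]; exact ⟨mem_perfectMatchings.2 hQ, hh⟩
  rw [not_and_or] at h'
  push Not at h'
  rcases h' with ⟨j, hj, M, hM, hQM⟩ | ⟨M, hM, hQM⟩
  · obtain ⟨s, hs, rfl⟩ := mem_cycles.1 hM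
    refine ⟨j + 1, inferInstance, s, hj.le, hs, (contains_cycEdges hQ).1 hQM,
      fun P hP => not_follows_of_lt hP hj hs, fun m hm _ hsub => ?_⟩
    have := hs.le_of_subset hm hsub
    omega
  · obtain ⟨s, hs, rfl⟩ := mem_cycles.1 (hT hM)
    refine ⟨k, inferInstance, s, le_rfl, hs, (contains_cycEdges hQ).1 hQM, fun P hP => ?_,
      fun m hm hmT hsub => hmT (hs.cycEdges_eq_of_subset hm hsub ▸ hM)⟩
    rw [avoid, mem_filter, mem_perfectMatchings] at hP
    rw [← contains_cycEdges hP.1]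
    exact hP.2.2 _ hM

/-- A forbidden cycle created by the switching uses a new edge. Following it from there to the next
new edge gives a path of `P`, with fewer than `k` edges, between two of `u`, `P u`, `z`, `P z`. It
must join one of the first two to one of the last two, so `z` or `P z` lies within reach of the edge
at `u`. -/
lemma nearlyClosed_avoid {d : ℕ} (hd : ∀ x, (univ.filter fun y => c y = c x).card ≤ d)
    (hd1 : 1 ≤ d) {T : Finset (Finset (Sym2 α))} (hT : T ⊆ cycles c k) :
    NearlyClosed (avoid c k T) (4 * k * d ^ k) := by
  intro P hP u
  have hPM := mem_perfectMatchings.1 (avoid_subset hP)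
  set R : Finset α := (range k).biUnion fun j => reach c P u j ∪ reach c P (P u) j with hR
  have hRcard : R.card ≤ 2 * k * d ^ k := by
    refine card_biUnion_le.trans ?_
    have : ∀ j ∈ range k, (reach c P u j ∪ reach c P (P u) j).card ≤ 2 * d ^ k := by
      intro j hj
      have h1 := (card_reach_le hd P u j).trans (Nat.pow_le_pow_right hd1 (mem_range.1 hj))
      have h2 := (card_reach_le hd P (P u) j).trans (Nat.pow_le_pow_right hd1 (mem_range.1 hj))
      have h3 := card_union_le (reach c P u j) (reach c P (P u) j)
      omega
    refine (sum_le_sum this).trans ?_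
    rw [sum_const, card_range, smul_eq_mul]
    exact le_of_eq (by ring)
  have hsub : (univ.filter fun z => z ≠ u ∧ sw P z (P u) ∉ avoid c k T) ⊆ R ∪ R.image P := by
    intro z hz
    simp only [mem_filter, mem_univ, true_and] at hz
    obtain ⟨hzu, hz⟩ := hz
    obtain ⟨r, _, s₀, hrk, hs₀, hQ₀, hnot, -⟩ := exists_cyc_of_notMem_avoid hT (hPM.sw z (P u)) hz
    set Q := sw P z (P u) with hQdef
    have hQM : IsPM Q := hPM.sw z (P u)
    set Sp : α → Prop := fun w => w = u ∨ w = P u ∨ w = z ∨ w = P z with hSp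
    have hPQ : ∀ w, ¬ Sp w → Q w = P w := by
      intro w hw
      simp only [hSp, not_or] at hw
      rw [hQdef, sw_apply, Equiv.swap_apply_of_ne_of_ne hw.2.2.1 hw.2.1,
        Equiv.swap_apply_of_ne_of_ne]
      · rintro hh; exact hw.2.2.2 (hPM.eq_symm hh).symm
      · rintro hh; exact hw.1 (P.injective hh)
    have hspec : ∃ i, Sp (s₀ i).2 := by
      by_contra hcon
      push Not at hcon
      exact hnot P hP fun i => by rw [← hPQ _ (hcon i), hQ₀]
    obtain ⟨i₀, hi₀⟩ := hspec
    set s := rotateCyc s₀ (i₀ + 1) with hs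
    have hsC : IsCyc c s := hs₀.rotate _
    have hQs : Follows Q s := hQ₀.rotate _
    have hlast : Sp (s (-1)).2 := by
      have : s (-1) = s₀ i₀ := by simp [hs, rotateCyc]
      rwa [this]
    obtain ⟨j, hjr, hSpj, -, hpath⟩ := hsC.exists_path hQs hPQ hlast
    have hSp0 : Sp (s 0).1 := by
      have h1 : Q (s (-1)).2 = (s 0).1 := by rw [hQs]; simp
      by_contra hcon
      have h2 := hQM.eq_symm h1
      rw [hPQ _ hcon] at h2
      have h3 := hPM.eq_symm h2
      have h4 : Sp (P (s (-1)).2) := by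
        rcases hlast with h | h | h | h <;> rw [h] <;> simp [hSp, hPM.1]
      exact hcon (h3 ▸ h4)
    set a : ℕ → α := fun i => (s (i : ZMod r)).1 with ha
    set b : ℕ → α := fun i => (s (i : ZMod r)).2 with hbdef
    have ha0 : a 0 = (s 0).1 := by simp [ha]
    rw [← ha0] at hSp0
    change Sp (b j) at hSpj
    have hne : b j ≠ a 0 := fun hh => by
      have h1 := hpath.inj j le_rfl 0 (by omega) (by rw [hpath.same j le_rfl, hh])
      subst h1
      exact hpath.ne 0 le_rfl hh.symm
    -- Otherwise the path closes up in `P` to a cycle of length `j + 1`. Below `k` this is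
    -- forbidden. Length `k` is not forbidden by itself, but then the path is the whole new cycle
    -- and `P`, `Q` agree at `b j`, whereas a nontrivial switching changes the partner of each
    -- special element.
    have hnP : P (b j) ≠ a 0 := fun hh => by
      obtain ⟨s', hs', hf⟩ := hpath.close hh
      by_cases hjk : j + 1 < k
      · exact not_follows_of_lt hP hjk hs' hf
      · have hjr' : j + 1 = r := by omega
        have h1 : Q (b j) = a 0 := by
          rw [ha0]
          simp only [hbdef]
          rw [hQs]
          have : ((j : ZMod r) + 1) = 0 := by
            rw [← Nat.cast_add_one, hjr', ZMod.natCast_self]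
          rw [this]
        have hzv : z ≠ P u := by
          rintro rfl
          have : sw P (P u) (P u) = P := by ext x; simp [sw_apply]
          exact hz (by rw [hQdef, this]; exact hP)
        have hQu : Q u = z := by
          rw [hQdef, sw_apply, Equiv.swap_apply_of_ne_of_ne hzu.symm (hPM.2 u).symm,
            Equiv.swap_apply_right]
        have hQv : Q (P u) = P z := by
          rw [hQdef, sw_apply, Equiv.swap_apply_right, Equiv.swap_apply_of_ne_of_ne (hPM.2 z)]
          exact fun hh => hzu (P.injective hh)
        have hPQbj : P (b j) = Q (b j) := hh.trans h1.symm
        rcases hSpj with h | h | h | h <;> rw [h] at hPQbj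
        · exact hzv (hPQbj.trans hQu).symm
        · rw [hQv, hPM.1] at hPQbj
          exact hzv (hPM.eq_symm hPQbj.symm).symm
        · rw [hQM.eq_symm hQu] at hPQbj
          exact hzv (hPM.eq_symm hPQbj).symm
        · rw [hQM.eq_symm hQv, hPM.1] at hPQbj
          exact hzv hPQbj
    have hfin : ∀ x y j, j < k → y ∈ reach c P x j → (x = u ∨ x = P u) → y ∈ R := by
      intro x y j hj hy hx
      rw [hR, mem_biUnion]
      refine ⟨j, mem_range.2 hj, ?_⟩
      rcases hx with rfl | rfl
      · exact mem_union_left _ hy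
      · exact mem_union_right _ hy
    have hr1 := hpath.mem_reach
    have hr2 := (hpath.reverse hPM).mem_reach
    simp only [Nat.sub_self, Nat.sub_zero] at hr2
    rw [mem_union, mem_image]
    have hjk : j < k := by omega
    -- Of the 16 pairs of ends, 4 are equal and 4 are partners in `P`; the other 8 put `z` or `P z`
    -- in `R`.
    rcases hSp0 with h | h | h | h <;> rcases hSpj with h' | h' | h' | h' <;>
      rw [h, h'] at hne hnP hr1 hr2 <;>
      first
      | exact absurd rfl hne
      | exact absurd rfl hnP
      | exact absurd (hPM.1 _) hnP
      | exact Or.inl (hfin _ _ j hjk hr1 (by simp))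
      | exact Or.inl (hfin _ _ j hjk hr2 (by simp))
      | exact Or.inr ⟨P z, hfin _ _ j hjk hr1 (by simp), hPM.1 z⟩
      | exact Or.inr ⟨P z, hfin _ _ j hjk hr2 (by simp), hPM.1 z⟩
  refine (card_le_card hsub).trans ((card_union_le _ _).trans ?_)
  have := card_image_le (s := R) (f := P)
  have e : 4 * k * d ^ k = 2 * k * d ^ k + 2 * k * d ^ k := by ring
  omega

end Avoid

/-! ### Bounds for the proportion of matchings containing a given cycle -/

section Lower

variable {α β : Type*} [Fintype α] [DecidableEq α] [DecidableEq β] {c : α → β}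
  {k : ℕ} [NeZero k]

lemma mem_verts_map {ι : Type*} (l : List ι) (f g : ι → α) {x : α} :
    x ∈ verts (l.map fun i => (f i, g i)) ↔ ∃ i ∈ l, x = f i ∨ x = g i := by
  rw [mem_verts]
  simp

lemma valid_map {ι : Type*} {l : List ι} (hl : l.Nodup) {f g : ι → α}
    (hf : Function.Injective f) (hg : Function.Injective g) (hfg : ∀ i j, f i ≠ g j) :
    Valid (l.map fun i => (f i, g i)) := by
  induction l with
  | nil => trivial
  | cons i l ih =>
    rw [List.nodup_cons] at hl
    refine ⟨hfg i i, ?_, ?_, ih hl.2⟩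
    · rw [mem_verts_map]
      rintro ⟨j, hj, h | h⟩
      · exact hl.1 (hf h ▸ hj)
      · exact hfg _ _ h
    · rw [mem_verts_map]
      rintro ⟨j, hj, h | h⟩
      · exact hfg _ _ h.symm
      · exact hl.1 (hg h ▸ hj)

/-- The list of the edges of a cycle. -/
noncomputable def cycList (s : ZMod k → α × α) : List (α × α) :=
  (univ : Finset (ZMod k)).toList.map fun i => ((s i).2, (s (i + 1)).1)

lemma length_cycList (s : ZMod k → α × α) : (cycList s).length = k := by
  simp [cycList, ZMod.card]

lemma verts_cycList (s : ZMod k → α × α) : verts (cycList s) = cycVerts s := by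
  ext x
  rw [cycList, mem_verts_map, mem_cycVerts]
  constructor
  · rintro ⟨i, -, h | h⟩
    · exact ⟨i, Or.inr h⟩
    · exact ⟨i + 1, Or.inl h⟩
  · rintro ⟨i, h | h⟩
    · exact ⟨i - 1, by simp, Or.inr (by simpa using h)⟩
    · exact ⟨i, by simp, Or.inl h⟩

lemma IsCyc.valid {s : ZMod k → α × α} (hs : IsCyc c s) : Valid (cycList s) := by
  refine valid_map (nodup_toList _) (fun i j h => ?_) (fun i j h => ?_) (fun i j h => ?_)
  · apply hs.eq_of_class
    rw [hs.same, h, hs.same]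
  · have := hs.eq_of_class (congrArg c h)
    simpa using this
  · have : i = j + 1 := hs.eq_of_class (by rw [hs.same, h])
    rw [this] at h
    exact hs.ne _ h.symm

lemma ext_cycList {P : Equiv.Perm α} (hP : IsPM P) {s : ZMod k → α × α} :
    Ext P (cycList s) ↔ Contains P (cycEdges s) := by
  rw [contains_cycEdges hP]
  simp [Ext, cycList, Follows]

/-- Some path of `P` of length at most `k` joins elements of `V`. -/
def Bad (c : α → β) (k : ℕ) (V : Finset α) (P : Equiv.Perm α) : Prop :=
  ∃ u ∈ V, ∃ τ ∈ V, ∃ j < k,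
    (∃ τ', c τ' = c τ ∧ j + 2 ≤ k ∧ Gap c P τ' j ∅ u) ∨ Gap c P τ j ∅ u ∨
      Gap c P τ j {u, P u} (P u)

noncomputable instance (c : α → β) (k : ℕ) (V : Finset α) (P : Equiv.Perm α) :
    Decidable (Bad c k V P) := Classical.dec _

/-- Forcing alters `P` only at elements that lie in `V` or have their `P`-partner in `V`. A
forbidden cycle created in this way is not contained in `m`, so at some point it leaves `V` along a
path of `P` that ends near `V` again. -/
lemma bad_of_force_notMem {T : Finset (Finset (Sym2 α))} (hT : T ⊆ cycles c k)
    {m : ZMod k → α × α} (hm : IsCyc c m) (hmT : cycEdges m ∉ T) {P : Equiv.Perm α}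
    (hP : P ∈ avoid c k T) (hQ : force P (cycList m) ∉ avoid c k T) :
    Bad c k (cycVerts m) P := by
  have hPM := mem_perfectMatchings.1 (avoid_subset hP)
  have hQM := hPM.force (cycList m)
  obtain ⟨r, _, s₀, hrk, hs₀, hQ₀, hnot, hnsub⟩ := exists_cyc_of_notMem_avoid hT hQM hQ
  have hnsub := hnsub m hm hmT
  set Q := force P (cycList m) with hQdef
  have hQext : Ext Q (cycList m) := ext_force hPM hm.valid
  have hQc : Contains Q (cycEdges m) := (ext_cycList hQM).1 hQext
  set V := cycVerts m with hV
  have hVQ : ∀ x ∈ V, Q x ∈ V := fun x hx => by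
    rw [hV, ← verts_cycList] at hx ⊢
    exact hQext.apply_mem hQM hx
  set Sp : α → Prop := fun w => w ∈ V ∨ P w ∈ V with hSp
  have hSpP : ∀ w, Sp w → Sp (P w) := by
    intro w hw
    simp only [hSp, hPM.1] at hw ⊢
    tauto
  have hPQ : ∀ w, ¬ Sp w → Q w = P w := by
    intro w hw
    simp only [hSp, not_or] at hw
    exact force_apply_of_notMem hPM (by rw [verts_cycList]; exact hw.1)
      (by rw [verts_cycList]; exact hw.2)
  have hSpQ : ∀ w, Sp w → Sp (Q w) := by
    intro w hw
    by_contra hcon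
    have h1 := hPQ _ hcon
    rw [hQM.1] at h1
    have h2 := hSpP w hw
    rw [h1, hPM.1] at h2
    exact hcon h2
  have hspec : ∃ i, Sp (s₀ i).2 := by
    by_contra hcon
    push Not at hcon
    exact hnot P hP fun i => by rw [← hPQ _ (hcon i), hQ₀]
  -- If the class after every special edge were crossed inside `V`, the cycle would never leave `V`.
  -- All its edges would then be edges of `m`.
  have hgood : ∃ i, Sp (s₀ i).2 ∧ ¬ ((s₀ (i + 1)).1 ∈ V ∧ (s₀ (i + 1)).2 ∈ V) := by
    by_contra hcon
    push Not at hcon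
    obtain ⟨i₀, hi₀⟩ := hspec
    have h1 : ∀ n : ℕ, (s₀ (i₀ + 1 + n)).2 ∈ V := by
      intro n
      induction n with
      | zero => simpa using (hcon i₀ hi₀).2
      | succ n ih =>
        have := (hcon _ (Or.inl ih)).2
        rwa [Nat.cast_add_one, ← add_assoc]
    refine hnsub fun e he => ?_
    obtain ⟨i, rfl⟩ := mem_cycEdges.1 he
    have h2 := h1 (i - (i₀ + 1)).val
    rw [ZMod.natCast_zmod_val, add_sub_cancel] at h2
    rw [← hQ₀ i]
    rw [hV, ← verts_cycList, cycList, mem_verts_map] at h2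
    obtain ⟨l, -, h3⟩ := h2
    have h4 : Q (m l).2 = (m (l + 1)).1 := hQc _ _ (mem_cycEdges.2 ⟨l, rfl⟩)
    rw [mem_cycEdges]
    refine ⟨l, ?_⟩
    rcases h3 with h3 | h3
    · rw [h3, h4]
    · rw [h3, hQM.eq_symm h4, Sym2.eq_swap]
  obtain ⟨i₀, hi₀, hi₁⟩ := hgood
  set s := rotateCyc s₀ (i₀ + 1) with hs
  have hsC : IsCyc c s := hs₀.rotate _
  have hQs : Follows Q s := hQ₀.rotate _
  have hlast : s (-1) = s₀ i₀ := by simp [hs, rotateCyc]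
  have hzero : s 0 = s₀ (i₀ + 1) := by simp [hs, rotateCyc]
  rw [← hlast] at hi₀
  rw [← hzero] at hi₁
  obtain ⟨j, hjr, hSpj, hmin, hpath⟩ := hsC.exists_path hQs hPQ hi₀
  have hSp0 : Sp (s 0).1 := by
    have h1 : Q (s (-1)).2 = (s 0).1 := by rw [hQs]; simp
    exact h1 ▸ hSpQ _ hi₀
  set a : ℕ → α := fun i => (s (i : ZMod r)).1 with ha
  set b : ℕ → α := fun i => (s (i : ZMod r)).2 with hbdef
  have ha0 : a 0 = (s 0).1 := by simp [ha]
  have hb0 : b 0 = (s 0).2 := by simp [hbdef]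
  rw [← ha0] at hSp0 hi₁
  rw [← hb0] at hi₁
  change Sp (b j) at hSpj
  -- Each end of the path is in `V` or is the `P`-partner of an element of `V`. If both are in `V`,
  -- the choice of `i₀` excludes `j = 0`, and the last edge is prescribed only up to the class of
  -- its end. If neither is, the edge leading from `V` to `a 0` must be exposed first, and
  -- minimality of `j` keeps the path off that edge.
  by_cases hA : a 0 ∈ V <;> by_cases hB : b j ∈ V
  · obtain _ | j := j
    · exact absurd ⟨hA, hB⟩ hi₁
    · refine ⟨a 0, hA, b (j + 1), hB, j, by omega, Or.inl ⟨a (j + 1), hpath.same _ le_rfl,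
        by omega, hpath.init.gap (hpath.link j (by omega)) (by simp)⟩⟩
  · have hB' : P (b j) ∈ V := hSpj.resolve_left hB
    exact ⟨a 0, hA, P (b j), hB', j, by omega, Or.inr (Or.inl (hpath.gap rfl (by simp)))⟩
  · have hA' : P (a 0) ∈ V := hSp0.resolve_left hA
    have := (hpath.reverse hPM).gap (τ := P (a 0)) (U := ∅) (by simp) (by simp)
    exact ⟨b j, hB, P (a 0), hA', j, by omega, Or.inr (Or.inl (by simpa using this))⟩
  · have hB' : P (b j) ∈ V := hSpj.resolve_left hB
    have hA' : P (a 0) ∈ V := hSp0.resolve_left hA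
    refine ⟨P (a 0), hA', P (b j), hB', j, by omega, Or.inr (Or.inr ?_)⟩
    rw [hPM.1]
    refine hpath.gap rfl fun i hi => ?_
    simp only [mem_insert, mem_singleton, not_or]
    constructor
    · rintro hh
      rcases hi.lt_or_eq with hi' | rfl
      · exact hmin i hi' (Or.inl (by rw [← hh] at hA'; exact hA'))
      · exact hB (hh ▸ hA')
    · intro hh
      have h1 := hpath.inj i hi 0 (by omega) (by rw [hpath.same i hi, hh])
      subst h1
      exact hpath.ne 0 hi hh.symm

/-- Union bound: each of the three kinds of path has proportion at most `d ^ k / D`. In the first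
kind the free choice of `τ'` costs another `d`, which `j + 2 ≤ k` pays for. In the third the partner
of `u` is exposed beforehand, hence lists of up to `k + 1` edges and the term `2 * (k + 1)`. -/
lemma card_bad_le {d : ℕ} (hd : ∀ x, (univ.filter fun y => c y = c x).card ≤ d) (hd1 : 1 ≤ d)
    {F : Finset (Equiv.Perm α)} (hF : F ⊆ perfectMatchings α) {b D : ℕ}
    (hb : NearlyClosed F b) (hD : D + 2 * (k + 1) + b ≤ Fintype.card α) {V : Finset α}
    (hV : V.card ≤ 2 * k) :
    (F.filter (Bad c k V)).card * D ≤ 12 * k ^ 3 * d ^ k * F.card := by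
  have hempty : ∀ (τ : α) (j : ℕ) (u : α), j < k →
      (F.filter fun P => Gap c P τ j ∅ u).card * D ≤ d ^ (j + 1) * F.card := by
    intro τ j u hj
    have := card_gap_le hd hF hb hD τ j (L := []) trivial (by simp; omega) u
    simpa [Ext, verts] using this
  have h1 : ∀ u τ, ∀ j < k, (F.filter fun P =>
      ∃ τ', c τ' = c τ ∧ j + 2 ≤ k ∧ Gap c P τ' j ∅ u).card * D ≤ d ^ k * F.card := by
    intro u τ j hj
    by_cases hjk : j + 2 ≤ k
    · have hsub : (F.filter fun P => ∃ τ', c τ' = c τ ∧ j + 2 ≤ k ∧ Gap c P τ' j ∅ u) ⊆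
          (univ.filter fun y => c y = c τ).biUnion fun τ' =>
            F.filter fun P => Gap c P τ' j ∅ u := by
        intro P hP
        rw [mem_filter] at hP
        obtain ⟨hPF, τ', h1, -, h2⟩ := hP
        rw [mem_biUnion]
        exact ⟨τ', by simpa using h1, mem_filter.2 ⟨hPF, h2⟩⟩
      refine (Nat.mul_le_mul_right D ((card_le_card hsub).trans card_biUnion_le)).trans ?_
      rw [sum_mul]
      refine (sum_le_sum fun τ' _ => hempty τ' j u hj).trans ?_
      rw [sum_const, smul_eq_mul, ← mul_assoc]
      refine Nat.mul_le_mul_right _ ?_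
      calc _ ≤ d * d ^ (j + 1) := Nat.mul_le_mul_right _ (hd τ)
        _ = d ^ (j + 2) := by ring
        _ ≤ d ^ k := Nat.pow_le_pow_right hd1 hjk
    · simp [hjk]
  have h2 : ∀ u τ, ∀ j < k, (F.filter fun P => Gap c P τ j ∅ u).card * D ≤ d ^ k * F.card := by
    intro u τ j hj
    exact (hempty τ j u hj).trans (Nat.mul_le_mul_right _ (Nat.pow_le_pow_right hd1 hj))
  have h3 : ∀ u τ, ∀ j < k, (F.filter fun P => Gap c P τ j {u, P u} (P u)).card * D ≤
      d ^ k * F.card := by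
    intro u τ j hj
    have hsub : (F.filter fun P => Gap c P τ j {u, P u} (P u)) ⊆
        univ.biUnion fun s => if u ≠ s then
          F.filter fun P => Ext P [(u, s)] ∧ Gap c P τ j (verts [(u, s)]) s else ∅ := by
      intro P hP
      rw [mem_filter] at hP
      have hPM := mem_perfectMatchings.1 (hF hP.1)
      rw [mem_biUnion]
      refine ⟨P u, mem_univ _, ?_⟩
      rw [if_pos (hPM.2 u).symm, mem_filter]
      exact ⟨hP.1, by simp [Ext], hP.2⟩
    refine (Nat.mul_le_mul_right D ((card_le_card hsub).trans card_biUnion_le)).trans ?_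
    rw [sum_mul]
    have h4 : ∀ s ∈ (univ : Finset α), (if u ≠ s then
          F.filter fun P => Ext P [(u, s)] ∧ Gap c P τ j (verts [(u, s)]) s else ∅).card * D ≤
          d ^ k * (F.filter fun P => Ext P [(u, s)]).card := by
      intro s _
      split_ifs with h
      · have := card_gap_le hd hF hb hD τ j (L := [(u, s)]) ⟨h, by simp [verts], by simp [verts],
          trivial⟩ (by simp; omega) s
        exact this.trans (Nat.mul_le_mul_right _ (Nat.pow_le_pow_right hd1 hj))
      · simp
    refine (sum_le_sum h4).trans ?_
    rw [← mul_sum]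
    refine Nat.mul_le_mul_left _ ((sum_card_ext_cons_le F [] u univ).trans ?_)
    exact card_filter_le _ _
  have hsub : F.filter (Bad c k V) ⊆ (V ×ˢ V ×ˢ range k).biUnion fun x =>
      (F.filter fun P => ∃ τ', c τ' = c x.2.1 ∧ x.2.2 + 2 ≤ k ∧ Gap c P τ' x.2.2 ∅ x.1) ∪
      ((F.filter fun P => Gap c P x.2.1 x.2.2 ∅ x.1) ∪
      F.filter fun P => Gap c P x.2.1 x.2.2 {x.1, P x.1} (P x.1)) := by
    intro P hP
    rw [mem_filter] at hP
    obtain ⟨hPF, u, hu, τ, hτ, j, hj, h⟩ := hP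
    rw [mem_biUnion]
    refine ⟨(u, τ, j), by simp [hu, hτ, hj], ?_⟩
    simp only [mem_union, mem_filter]
    exact h.imp (⟨hPF, ·⟩) (Or.imp (⟨hPF, ·⟩) (⟨hPF, ·⟩))
  have h5 : ∀ x ∈ V ×ˢ V ×ˢ range k,
      ((F.filter fun P => ∃ τ', c τ' = c x.2.1 ∧ x.2.2 + 2 ≤ k ∧ Gap c P τ' x.2.2 ∅ x.1) ∪
      ((F.filter fun P => Gap c P x.2.1 x.2.2 ∅ x.1) ∪
      F.filter fun P => Gap c P x.2.1 x.2.2 {x.1, P x.1} (P x.1))).card * D ≤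
        3 * (d ^ k * F.card) := by
    rintro ⟨u, τ, j⟩ hx
    simp only [mem_product, mem_range] at hx
    obtain ⟨-, -, hj⟩ := hx
    have e1 := h1 u τ j hj
    have e2 := h2 u τ j hj
    have e3 := h3 u τ j hj
    refine (Nat.mul_le_mul_right D ((card_union_le _ _).trans
      (Nat.add_le_add_left (card_union_le _ _) _))).trans ?_
    rw [add_mul, add_mul]
    refine (add_le_add e1 (add_le_add e2 e3)).trans (le_of_eq (by ring))
  refine (Nat.mul_le_mul_right D ((card_le_card hsub).trans card_biUnion_le)).trans ?_
  rw [sum_mul]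
  refine (sum_le_sum h5).trans ?_
  rw [sum_const, card_product, card_product, card_range, smul_eq_mul]
  -- At most `(2k) ^ 2` pairs of ends, `k` lengths and 3 kinds of path give the constant 12.
  calc V.card * (V.card * k) * (3 * (d ^ k * F.card))
      ≤ (2 * k) * ((2 * k) * k) * (3 * (d ^ k * F.card)) := by gcongr
    _ = _ := by ring

/-- Lower bound for the number of members of `avoid c k T` that contain a given cycle of length
`k`. -/
lemma le_card_contains {d : ℕ} (hd : ∀ x, (univ.filter fun y => c y = c x).card ≤ d)
    (hd1 : 1 ≤ d) {T : Finset (Finset (Sym2 α))} (hT : T ⊆ cycles c k)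
    {M : Finset (Sym2 α)} (hM : M ∈ cycles c k) (hMT : M ∉ T) {D : ℕ}
    (hD : D + 2 * (k + 1) + 4 * k * d ^ k ≤ Fintype.card α) :
    (avoid c k T).card * D ≤ 12 * k ^ 3 * d ^ k * (avoid c k T).card +
      ((avoid c k T).filter fun P => Contains P M).card * Fintype.card α ^ k * D := by
  obtain ⟨m, hm, rfl⟩ := mem_cycles.1 hM
  set F := avoid c k T with hF
  have h1 := card_bad_le hd hd1 avoid_subset (nearlyClosed_avoid hd hd1 hT) hD
    (V := cycVerts m) hm.card_cycVerts.le
  have h2 : (F.filter fun P => ¬ Bad c k (cycVerts m) P).card ≤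
      (F.filter fun P => Contains P (cycEdges m)).card * Fintype.card α ^ k := by
    have := card_le_of_force_mem (A := F.filter fun P => ¬ Bad c k (cycVerts m) P)
      (B := F.filter fun P => Contains P (cycEdges m)) hm.valid ?_
    · rwa [length_cycList] at this
    · intro P hP
      rw [mem_filter] at hP
      have hPM := mem_perfectMatchings.1 (avoid_subset hP.1)
      have hin : force P (cycList m) ∈ F := by
        by_contra hcon
        exact hP.2 (bad_of_force_notMem hT hm hMT hP.1 hcon)
      rw [mem_filter]
      exact ⟨hin, (ext_cycList (hPM.force _)).1 (ext_force hPM hm.valid)⟩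
  have h3 := card_filter_add_card_filter_not (s := F) (Bad c k (cycVerts m))
  calc F.card * D = (F.filter (Bad c k (cycVerts m))).card * D +
        (F.filter fun P => ¬ Bad c k (cycVerts m) P).card * D := by rw [← add_mul, h3]
    _ ≤ _ := Nat.add_le_add h1 (Nat.mul_le_mul_right _ h2)

/-- Upper bound for the number of members of `avoid c k T` that contain a given cycle of length
`k`. -/
lemma card_contains_le {d : ℕ} (hd : ∀ x, (univ.filter fun y => c y = c x).card ≤ d)
    (hd1 : 1 ≤ d) {T : Finset (Finset (Sym2 α))} (hT : T ⊆ cycles c k)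
    {M : Finset (Sym2 α)} (hM : M ∈ cycles c k) {D : ℕ}
    (hD : D + 2 * (k + 1) + 4 * k * d ^ k ≤ Fintype.card α) :
    ((avoid c k T).filter fun P => Contains P M).card * D ^ k ≤ (avoid c k T).card := by
  obtain ⟨m, hm, rfl⟩ := mem_cycles.1 hM
  have h1 := card_ext_mul_pow_le (nearlyClosed_avoid hd hd1 hT) hD hm.valid
    (by rw [length_cycList]; omega)
  rw [length_cycList] at h1
  convert h1 using 3
  refine filter_congr fun P hP => ?_
  rw [ext_cycList (mem_perfectMatchings.1 (avoid_subset hP))]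

end Lower

/-! ### Multiplying the conditional probabilities -/

section Product

variable {α β : Type*} [Fintype α] [DecidableEq α] [DecidableEq β] {c : α → β}

lemma avoid_insert (k : ℕ) (T : Finset (Finset (Sym2 α))) (M : Finset (Sym2 α)) :
    avoid c k (insert M T) = (avoid c k T).filter fun P => ¬ Contains P M := by
  ext P
  simp only [avoid, mem_filter, mem_insert, forall_eq_or_imp]
  tauto

lemma avoid_succ (k : ℕ) : avoid c (k + 1 + 1) ∅ = avoid c (k + 1) (cycles c (k + 1)) := by
  ext P
  simp only [avoid, mem_filter, notMem_empty, false_imp_iff, implies_true, and_true]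
  refine and_congr_right fun _ => ⟨fun h => ⟨fun j hj => h j (by omega), h k (by omega)⟩,
    fun h j hj => ?_⟩
  rcases (show j ≤ k by omega).lt_or_eq with hj' | rfl
  · exact h.1 j (by omega)
  · exact h.2

lemma avoid_one : avoid c 1 ∅ = perfectMatchings α := by
  ext P
  simp [avoid]

lemma exp_neg_div_le {q : ℝ} (hq : q < 1) : Real.exp (-(q / (1 - q))) ≤ 1 - q := by
  have h1 : 0 < 1 - q := by linarith
  rw [Real.exp_neg, inv_le_comm₀ (Real.exp_pos _) h1]
  refine le_trans (le_of_eq ?_) (Real.add_one_le_exp _)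
  field_simp
  ring

/-- Each cycle added to `T` contributes a factor `1 - p`, with `p` bounded on both sides uniformly
in `T`. It is turned into an exponential by `1 - p ≤ exp (-p)` and `exp (-q / (1 - q)) ≤ 1 - q`. -/
lemma card_avoid_bounds {k : ℕ} [NeZero k] {d : ℕ}
    (hd : ∀ x, (univ.filter fun y => c y = c x).card ≤ d)
    (hd1 : 1 ≤ d) {D : ℕ} (hD2 : 2 ≤ D)
    (hD : D + 2 * (k + 1) + 4 * k * d ^ k ≤ Fintype.card α)
    {T : Finset (Finset (Sym2 α))} (hT : T ⊆ cycles c k) :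
    Real.exp (-(T.card * (1 / ((D : ℝ) - 1) ^ k))) * (avoid c k ∅).card ≤ (avoid c k T).card ∧
    ((avoid c k T).card : ℝ) ≤ Real.exp (-(T.card *
      ((1 - 12 * k ^ 3 * d ^ k / D) / (Fintype.card α : ℝ) ^ k))) * (avoid c k ∅).card := by
  induction T using Finset.induction_on with
  | empty => simp
  | insert M T hMT ih =>
    have hTc : T ⊆ cycles c k := (subset_insert _ _).trans hT
    have hM : M ∈ cycles c k := hT (mem_insert_self _ _)
    obtain ⟨ih1, ih2⟩ := ih hTc
    have hsplit := card_filter_add_card_filter_not (s := avoid c k T) (fun P => Contains P M)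
    have h1 := le_card_contains hd hd1 hTc hM hMT hD
    have h2 := card_contains_le hd hd1 hTc hM hD
    rw [avoid_insert, card_insert_of_notMem hMT]
    set A := ((avoid c k T).filter fun P => Contains P M).card
    set B := ((avoid c k T).filter fun P => ¬ Contains P M).card
    set f := (avoid c k T).card
    have hDpos : (0 : ℝ) < D := by exact_mod_cast (by omega : 0 < D)
    have hNpos : (0 : ℝ) < Fintype.card α := by
      exact_mod_cast (by omega : 0 < Fintype.card α)
    have hsplit' : (A : ℝ) + B = f := by exact_mod_cast hsplit
    have h1' : (f : ℝ) * D ≤ 12 * k ^ 3 * d ^ k * f + A * (Fintype.card α : ℝ) ^ k * D := by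
      exact_mod_cast h1
    have h2' : (A : ℝ) * D ^ k ≤ f := by exact_mod_cast h2
    have hf0 : (0 : ℝ) ≤ f := Nat.cast_nonneg _
    set x : ℝ := 1 / ((D : ℝ) - 1) ^ k
    set p : ℝ := (1 - 12 * k ^ 3 * d ^ k / D) / (Fintype.card α : ℝ) ^ k with hp
    have hB1 : Real.exp (-x) * f ≤ B := by
      have hD1 : (1 : ℝ) ≤ (D : ℝ) - 1 := by
        have : (2 : ℝ) ≤ D := by exact_mod_cast hD2
        linarith
      -- For `q = 1 / D ^ k` one has `q / (1 - q) = 1 / (D ^ k - 1)`; this replaces it by the pure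
      -- power `1 / (D - 1) ^ k`.
      have hpow : ((D : ℝ) - 1) ^ k + 1 ≤ (D : ℝ) ^ k := by
        have h := pow_add_pow_le (x := (D : ℝ) - 1) (y := 1) (by linarith) zero_le_one
          (NeZero.ne k)
        simpa using h
      have hD1k : (1 : ℝ) ≤ ((D : ℝ) - 1) ^ k := one_le_pow₀ hD1
      set q : ℝ := 1 / (D : ℝ) ^ k
      have hDk : (0 : ℝ) < (D : ℝ) ^ k := by positivity
      have hq : q < 1 := by
        rw [div_lt_one hDk]; linarith
      have hqx : q / (1 - q) ≤ x := by
        have : q / (1 - q) = 1 / ((D : ℝ) ^ k - 1) := by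
          simp only [q]
          have : (D : ℝ) ^ k - 1 ≠ 0 := by linarith
          field_simp
        rw [this]
        exact one_div_le_one_div_of_le (by linarith) (by linarith)
      have h3 : Real.exp (-x) ≤ 1 - q :=
        le_trans (Real.exp_le_exp.2 (by linarith)) (exp_neg_div_le hq)
      have h4 : (A : ℝ) ≤ q * f := by
        rw [one_div_mul_eq_div, le_div_iff₀ hDk]; exact h2'
      nlinarith
    have hB2 : (B : ℝ) ≤ Real.exp (-p) * f := by
      have h3 := Real.add_one_le_exp (-p)
      have h4 : p * f ≤ A := by
        rw [hp, div_mul_eq_mul_div, div_le_iff₀ (by positivity)]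
        have : (1 - 12 * (k : ℝ) ^ 3 * d ^ k / D) * f * D ≤ A * (Fintype.card α : ℝ) ^ k * D := by
          have e : (1 - 12 * (k : ℝ) ^ 3 * d ^ k / D) * f * D =
              f * D - 12 * (k : ℝ) ^ 3 * d ^ k * f := by field_simp
          rw [e]; linarith
        exact le_of_mul_le_mul_right this hDpos
      nlinarith
    push_cast
    constructor
    · calc Real.exp (-((T.card + 1) * x)) * (avoid c k ∅).card
          = Real.exp (-x) * (Real.exp (-(T.card * x)) * (avoid c k ∅).card) := by
            rw [← mul_assoc, ← Real.exp_add]; ring_nf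
        _ ≤ Real.exp (-x) * f := by gcongr
        _ ≤ B := hB1
    · calc (B : ℝ) ≤ Real.exp (-p) * f := hB2
        _ ≤ Real.exp (-p) * (Real.exp (-(T.card * p)) * (avoid c k ∅).card) := by gcongr
        _ = _ := by rw [← mul_assoc, ← Real.exp_add]; ring_nf

lemma card_avoid_prod_bounds {d : ℕ}
    (hd : ∀ x, (univ.filter fun y => c y = c x).card ≤ d)
    (hd1 : 1 ≤ d) {D : ℕ} (hD2 : 2 ≤ D) (G : ℕ)
    (hD : D + 2 * (G + 1) + 4 * G * d ^ G ≤ Fintype.card α) :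
    Real.exp (-∑ j ∈ range G, (cycles c (j + 1)).card * (1 / ((D : ℝ) - 1) ^ (j + 1))) *
      (perfectMatchings α).card ≤ (avoid c (G + 1) ∅).card ∧
    ((avoid c (G + 1) ∅).card : ℝ) ≤ Real.exp (-∑ j ∈ range G, (cycles c (j + 1)).card *
      ((1 - 12 * ((j + 1 : ℕ) : ℝ) ^ 3 * d ^ (j + 1) / D) / (Fintype.card α : ℝ) ^ (j + 1))) *
      (perfectMatchings α).card := by
  induction G with
  | zero => simp [avoid_one]
  | succ G ih =>
    have hpow : d ^ G ≤ d ^ (G + 1) := Nat.pow_le_pow_right hd1 (Nat.le_succ _)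
    obtain ⟨ih1, ih2⟩ := ih (le_trans (by gcongr <;> omega) hD)
    obtain ⟨h1, h2⟩ := card_avoid_bounds (c := c) (k := G + 1) hd hd1 hD2 hD Subset.rfl
    rw [sum_range_succ, sum_range_succ, avoid_succ, neg_add, neg_add, add_comm, Real.exp_add,
      add_comm (-∑ j ∈ range G, _), Real.exp_add, mul_assoc, mul_assoc]
    exact ⟨le_trans (by gcongr) h1, h2.trans (by gcongr)⟩

end Product

/-! ### The exact number of cycles of each length -/

section Counting

/-- Choose the `k` distinct classes in order, then in each class an ordered pair of distinct
elements. -/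
lemma card_isCyc (n d k : ℕ) [NeZero k] :
    (univ.filter fun s : ZMod k → MiniVertex n d × MiniVertex n d =>
      IsCyc Prod.fst s).card = n.descFactorial k * (d * (d - 1)) ^ k := by
  classical
  let e : {s : ZMod k → MiniVertex n d × MiniVertex n d // IsCyc Prod.fst s} ≃
      (ZMod k ↪ Fin n) × (ZMod k → {p : Fin d × Fin d // p.1 ≠ p.2}) :=
    { toFun := fun s => (⟨fun i => (s.1 i).1.1, s.2.inj⟩, fun i => ⟨((s.1 i).1.2, (s.1 i).2.2),
        fun h => s.2.ne i (Prod.ext (s.2.same i) h)⟩)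
      invFun := fun x => ⟨fun i => ((x.1 i, (x.2 i).1.1), (x.1 i, (x.2 i).1.2)),
        ⟨fun _ => rfl, fun i h => (x.2 i).2 (congrArg Prod.snd h), x.1.injective⟩⟩
      left_inv := fun s => by
        ext i : 2
        have := s.2.same i
        refine Prod.ext rfl (Prod.ext this rfl)
      right_inv := fun x => rfl }
  have h1 : Fintype.card {p : Fin d × Fin d // p.1 ≠ p.2} = d * (d - 1) := by
    rw [Fintype.card_subtype]
    have : (univ.filter fun p : Fin d × Fin d => p.1 ≠ p.2) = (univ : Finset (Fin d)).offDiag := by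
      ext p; simp
    rw [this, offDiag_card, card_univ, Fintype.card_fin, Nat.mul_sub_one]
  rw [← Fintype.card_subtype, Fintype.card_congr e, Fintype.card_prod, Fintype.card_embedding_eq,
    Fintype.card_fun, h1, ZMod.card, Fintype.card_fin]

lemma card_cycles (n d k : ℕ) [NeZero k] :
    (cycles (Prod.fst : MiniVertex n d → Fin n) k).card * (2 * k) =
      n.descFactorial k * (d * (d - 1)) ^ k := by
  rw [card_cycles_mul, card_isCyc]

lemma card_class (n d : ℕ) (x : MiniVertex n d) :
    (univ.filter fun y : MiniVertex n d => y.1 = x.1).card ≤ d := by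
  have : (univ.filter fun y : MiniVertex n d => y.1 = x.1) = {x.1} ×ˢ univ := by
    ext y
    simp only [mem_filter, mem_univ, true_and, mem_product, mem_singleton, and_true]
  rw [this, card_product]; simp

end Counting

/-! ### Explicit error terms in the exponent -/

section Estimates

/-- The expected number of cycles of length `k`, up to lower order terms. -/
noncomputable def mean (d k : ℕ) : ℝ := ((d : ℝ) - 1) ^ k / (2 * (k : ℝ))

lemma mean_nonneg {d : ℕ} (hd : 1 ≤ d) (k : ℕ) : 0 ≤ mean d k := by
  have : (1 : ℝ) ≤ d := by exact_mod_cast hd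
  unfold mean
  have : (0 : ℝ) ≤ (d : ℝ) - 1 := by linarith
  positivity

lemma card_cycles_eq {n d k : ℕ} [NeZero k] (hd : 1 ≤ d) :
    ((cycles (Prod.fst : MiniVertex n d → Fin n) k).card : ℝ) =
      mean d k * ((n.descFactorial k : ℝ) * (d : ℝ) ^ k) := by
  have h := card_cycles n d k
  have hk : (0 : ℝ) < k := by exact_mod_cast Nat.pos_of_ne_zero (NeZero.ne k)
  have h' : ((cycles (Prod.fst : MiniVertex n d → Fin n) k).card : ℝ) * (2 * k) =
      n.descFactorial k * (d * ((d : ℝ) - 1)) ^ k := by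
    have : ((d - 1 : ℕ) : ℝ) = (d : ℝ) - 1 := by rw [Nat.cast_sub hd]; simp
    rw [← this]
    exact_mod_cast h
  rw [mean, div_mul_eq_mul_div, eq_div_iff (by positivity), h', mul_pow]
  ring

lemma mean_mul_le {d k g : ℕ} (hd : 1 ≤ d) (hk : 1 ≤ k) (hkg : k ≤ g - 1) :
    mean d k * (2 * k) ≤ (d : ℝ) ^ (g - 1) := by
  have h1 : (1 : ℝ) ≤ d := by exact_mod_cast hd
  have hk' : (0 : ℝ) < k := by exact_mod_cast hk
  rw [mean, div_mul_cancel₀ _ (by positivity)]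
  calc ((d : ℝ) - 1) ^ k ≤ (d : ℝ) ^ k := pow_le_pow_left₀ (by linarith) (by linarith) k
    _ ≤ _ := pow_le_pow_right₀ h1 hkg

/-- Replacing `N` by `D'` multiplies the mean by at most `(1 + S / D') ^ k ≤ 1 + 2k S / D'`; the
factor `2k` cancels the denominator of `mean d k`. -/
lemma card_cycles_mul_inv_pow_le {n d k g : ℕ} [NeZero k] (hd : 1 ≤ d) (hkg : k ≤ g - 1) {D' S : ℝ}
    (hN : (n : ℝ) * d = D' + S) (hD' : 0 < D') (hS : 0 ≤ S) (hkS : k * S ≤ D') :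
    ((cycles (Prod.fst : MiniVertex n d → Fin n) k).card : ℝ) * (1 / D' ^ k) ≤
      mean d k + (d : ℝ) ^ (g - 1) * (S / D') := by
  have hk : 1 ≤ k := Nat.pos_of_ne_zero (NeZero.ne k)
  have hy0 : 0 ≤ S / D' := by positivity
  have hky : k * (S / D') ≤ 1 := by
    rw [← mul_div_assoc, div_le_one hD']; exact hkS
  have h1 : (n.descFactorial k : ℝ) ≤ (n : ℝ) ^ k := by
    exact_mod_cast Nat.descFactorial_le_pow n k
  have h2 : ((n.descFactorial k : ℝ) * (d : ℝ) ^ k) / D' ^ k ≤ (1 + S / D') ^ k := by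
    have : 1 + S / D' = (n : ℝ) * d / D' := by rw [hN]; field_simp
    rw [this, div_pow, mul_pow]
    gcongr
  have h3 : (1 + S / D') ^ k ≤ 1 + 2 * k * (S / D') := by
    have e1 : (1 + S / D') ^ k ≤ Real.exp (k * (S / D')) := by
      rw [Real.exp_nat_mul]
      exact pow_le_pow_left₀ (by positivity) (by linarith [Real.add_one_le_exp (S / D')]) k
    have e2 := Real.abs_exp_sub_one_sub_id_le (x := k * (S / D'))
      (by rw [abs_of_nonneg (by positivity)]; exact hky)
    have e3 := (abs_le.1 e2).2
    have e4 : 0 ≤ k * (S / D') := by positivity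
    nlinarith
  have h4 := mean_nonneg hd k
  have h5 := mean_mul_le (d := d) hd hk hkg
  rw [card_cycles_eq hd, mul_one_div, mul_div_assoc]
  calc _ ≤ mean d k * (1 + 2 * k * (S / D')) := by gcongr; exact h2.trans h3
    _ = mean d k + mean d k * (2 * k) * (S / D') := by ring
    _ ≤ _ := by gcongr

lemma le_card_cycles_mul {n d k : ℕ} [NeZero k] (hd : 1 ≤ d) (hkn : k ≤ n) {B : ℝ}
    (hB0 : 0 ≤ B) (hB1 : B ≤ 1) :
    mean d k - mean d k * ((k : ℝ) ^ 2 / n + B) ≤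
      ((cycles (Prod.fst : MiniVertex n d → Fin n) k).card : ℝ) *
        ((1 - B) / ((n : ℝ) * d) ^ k) := by
  have hk : 1 ≤ k := Nat.pos_of_ne_zero (NeZero.ne k)
  have hn : (0 : ℝ) < n := by exact_mod_cast (by omega : 0 < n)
  have hd' : (0 : ℝ) < d := by exact_mod_cast hd
  have h1 : ((n : ℝ) - k) ^ k ≤ (n.descFactorial k : ℝ) := by
    have e := Nat.pow_sub_le_descFactorial n k
    have : (((n - k : ℕ) : ℝ)) ^ k ≤ (n.descFactorial k : ℝ) := by
      exact_mod_cast (Nat.pow_le_pow_left (by omega) k).trans e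
    rwa [Nat.cast_sub hkn] at this
  have hkn' : (k : ℝ) ≤ n := by exact_mod_cast hkn
  have h2 : 1 - (k : ℝ) ^ 2 / n ≤ (n.descFactorial k : ℝ) / (n : ℝ) ^ k := by
    calc 1 - (k : ℝ) ^ 2 / n = 1 + k * (-(k / n)) := by ring
      _ ≤ (1 + -(k / n)) ^ k := by
        refine one_add_mul_le_pow ?_ k
        have : (k : ℝ) / n ≤ 1 := (div_le_one hn).2 hkn'
        linarith
      _ = ((n : ℝ) - k) ^ k / (n : ℝ) ^ k := by rw [← div_pow]; congr 1; field_simp; ring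
      _ ≤ _ := by gcongr
  have h4 := mean_nonneg hd k
  have h5 : 0 ≤ (k : ℝ) ^ 2 / n := by positivity
  rw [card_cycles_eq hd]
  have e : mean d k * ((n.descFactorial k : ℝ) * (d : ℝ) ^ k) * ((1 - B) / ((n : ℝ) * d) ^ k) =
      mean d k * ((n.descFactorial k : ℝ) / (n : ℝ) ^ k * (1 - B)) := by
    rw [mul_pow]; field_simp
  rw [e]
  have h6 : 1 - ((k : ℝ) ^ 2 / n + B) ≤ (n.descFactorial k : ℝ) / (n : ℝ) ^ k * (1 - B) := by
    refine le_trans ?_ (mul_le_mul_of_nonneg_right h2 (by linarith))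
    nlinarith [mul_nonneg h5 hB0]
  have h7 := mul_le_mul_of_nonneg_left h6 h4
  linarith

set_option maxHeartbeats 1600000 in
/-- The number of perfect matchings whose projection has girth at least `g`: the estimate with an
explicit error term. -/
lemma card_avoid_estimate {n d g : ℕ} (hd : 3 ≤ d) (hg : 3 ≤ g) (hn : 0 < n) {X : ℝ}
    (hX : X = (g : ℝ) ^ 3 * (d : ℝ) ^ (2 * g - 3) / n) (hX1 : X ≤ 1 / 100) :
    Real.exp (-∑ j ∈ range (g - 1), mean d (j + 1) - 14 * X) *
      (perfectMatchings (MiniVertex n d)).card ≤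
        (avoid (Prod.fst : MiniVertex n d → Fin n) g ∅).card ∧
    ((avoid (Prod.fst : MiniVertex n d → Fin n) g ∅).card : ℝ) ≤
      Real.exp (-∑ j ∈ range (g - 1), mean d (j + 1) + 14 * X) *
        (perfectMatchings (MiniVertex n d)).card := by
  have hd1 : 1 ≤ d := by omega
  obtain ⟨G, rfl⟩ : ∃ G, g = G + 1 := ⟨g - 1, by omega⟩
  simp only [Nat.add_sub_cancel]
  set a : ℝ := (d : ℝ) ^ G with ha
  have hdR : (3 : ℝ) ≤ d := by exact_mod_cast hd
  have hnR : (0 : ℝ) < n := by exact_mod_cast hn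
  have hgR : (3 : ℝ) ≤ ((G + 1 : ℕ) : ℝ) := by exact_mod_cast hg
  set γ : ℝ := ((G + 1 : ℕ) : ℝ) with hγ
  have hGγ : (G : ℝ) + 1 = γ := by rw [hγ]; push_cast; ring
  have ha1 : 1 ≤ a := one_le_pow₀ (by linarith)
  set N : ℝ := (n : ℝ) * d with hN
  have hNpos : 0 < N := by positivity
  -- With `a = d ^ (g - 1)` the odd exponent `2g - 3` becomes a square after multiplication by the
  -- `d` in `N = nd`. All errors below are compared with this quantity.
  have hXN : X * N = γ ^ 3 * a ^ 2 := by
    have : (d : ℝ) ^ (2 * (G + 1) - 3) * d = a ^ 2 := by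
      rw [ha, ← pow_succ, ← pow_mul]; congr 1; omega
    rw [hX, hN, ← this]; field_simp
  have hX0 : 0 ≤ X := by rw [hX]; positivity
  have haa : a ≤ a ^ 2 := by nlinarith
  have hγ1 : 1 ≤ γ := by linarith
  have hγ2 : γ ≤ γ ^ 2 := by nlinarith
  have hγ3 : γ ^ 2 ≤ γ ^ 3 := by nlinarith
  -- the powers of `γ` and `a` that occur are at most `X * N`
  have hb : ∀ u v : ℝ, 0 ≤ u → u ≤ γ ^ 3 → 0 ≤ v → v ≤ a ^ 2 → u * v ≤ X * N := by
    intro u v hu hu' hv hv'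
    rw [hXN]; exact mul_le_mul hu' hv' hv (by positivity)
  set S : ℕ := 2 * (G + 1) + 4 * G * d ^ G with hS
  have hSR : (S : ℝ) + 1 ≤ 7 * (γ * a) := by
    have : (S : ℝ) = 2 * γ + 4 * G * a := by rw [hS, hγ, ha]; push_cast; ring
    rw [this]
    have : (G : ℝ) = γ - 1 := by linarith
    rw [this]
    nlinarith [mul_nonneg (sub_nonneg.2 hγ1) (sub_nonneg.2 ha1)]
  have hγa : γ * a ≤ X * N := hb γ a (by linarith) (by linarith) (by linarith) haa
  have hXN1 : X * N ≤ N / 100 := by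
    rw [div_eq_inv_mul, ← one_div]
    exact mul_le_mul_of_nonneg_right hX1 hNpos.le
  have hSN : (S : ℝ) + 1 ≤ N / 2 := by linarith
  have hSnat : S + 1 ≤ n * d := by
    have : ((S + 1 : ℕ) : ℝ) ≤ ((n * d : ℕ) : ℝ) := by push_cast; linarith
    exact_mod_cast this
  have hN7 : 63 ≤ N := by
    have h1 := hb 1 1 (by norm_num) (by linarith) (by norm_num) (by linarith)
    linarith
  set D : ℕ := n * d - S with hD
  have hDR : (D : ℝ) = N - S := by
    rw [hD, Nat.cast_sub (by omega), hN]; push_cast; ring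
  have hD1 : N / 2 ≤ (D : ℝ) - 1 := by rw [hDR]; linarith
  have hD2 : 2 ≤ D := by
    have : (2 : ℝ) ≤ D := by linarith
    exact_mod_cast this
  have hcard : Fintype.card (MiniVertex n d) = n * d := by simp
  obtain ⟨h1, h2⟩ := card_avoid_prod_bounds (card_class n d) hd1 hD2 G (by rw [hcard]; omega)
  have hk : ∀ j ∈ range G, ((j + 1 : ℕ) : ℝ) ≤ γ := fun j hj => by
    rw [hγ]; exact_mod_cast (by have := mem_range.1 hj; omega)
  have hGle : (G : ℝ) ≤ γ := by linarith
  constructor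
  · refine le_trans ?_ h1
    gcongr
    have hterm : ∀ j ∈ range G, ((cycles (Prod.fst : MiniVertex n d → Fin n) (j + 1)).card : ℝ) *
        (1 / ((D : ℝ) - 1) ^ (j + 1)) ≤ mean d (j + 1) + 14 * (γ * a ^ 2) / N := by
      intro j hj
      have hj' := mem_range.1 hj
      have e := card_cycles_mul_inv_pow_le (n := n) (d := d) (k := j + 1) (g := G + 1) hd1
        (by omega) (D' := (D : ℝ) - 1) (S := S + 1) (by rw [hDR]; ring) (by linarith)
        (by positivity) (by
          have e1 : ((j + 1 : ℕ) : ℝ) * (S + 1) ≤ γ * (7 * (γ * a)) :=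
            mul_le_mul (hk j hj) hSR (by positivity) (by linarith)
          have e2 : γ ^ 2 * a ≤ X * N := hb _ _ (by positivity) hγ3 (by linarith) haa
          have e3 : γ * (7 * (γ * a)) = 7 * (γ ^ 2 * a) := by ring
          linarith)
      refine e.trans ?_
      rw [Nat.add_sub_cancel, ← ha]
      gcongr
      -- The constant 14 arises here, from `S + 1 ≤ 7γa` and `D - 1 ≥ N / 2`.
      have e3 : ((S : ℝ) + 1) / ((D : ℝ) - 1) ≤ 7 * (γ * a) / (N / 2) :=
        div_le_div₀ (by positivity) hSR (by positivity) hD1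
      calc a * (((S : ℝ) + 1) / ((D : ℝ) - 1)) ≤ a * (7 * (γ * a) / (N / 2)) := by gcongr
        _ = 14 * (γ * a ^ 2) / N := by field_simp; ring
    have hsum := sum_le_sum hterm
    rw [sum_add_distrib, sum_const, card_range, nsmul_eq_mul] at hsum
    have : (G : ℝ) * (14 * (γ * a ^ 2) / N) ≤ 14 * X := by
      have e1 : γ ^ 2 * a ^ 2 ≤ X * N := hb _ _ (by positivity) hγ3 (by positivity) le_rfl
      have e2 : (G : ℝ) * (γ * a ^ 2) ≤ γ * (γ * a ^ 2) := by gcongr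
      rw [← mul_div_assoc, div_le_iff₀ hNpos]
      have e3 : γ * (γ * a ^ 2) = γ ^ 2 * a ^ 2 := by ring
      linarith
    linarith
  · refine h2.trans ?_
    gcongr
    have hterm : ∀ j ∈ range G, mean d (j + 1) - (γ * a / n + 12 * (γ ^ 2 * a ^ 2) / N) ≤
        ((cycles (Prod.fst : MiniVertex n d → Fin n) (j + 1)).card : ℝ) *
        ((1 - 12 * ((j + 1 : ℕ) : ℝ) ^ 3 * d ^ (j + 1) / D) /
          (Fintype.card (MiniVertex n d) : ℝ) ^ (j + 1)) := by
      intro j hj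
      have hj' := mem_range.1 hj
      have hkj := hk j hj
      have hDN : N / 2 ≤ (D : ℝ) := by linarith
      have hDpos : (0 : ℝ) < D := by linarith
      have hda : (d : ℝ) ^ (j + 1) ≤ a := pow_le_pow_right₀ (by linarith) (by omega)
      have hB1 : 12 * ((j + 1 : ℕ) : ℝ) ^ 3 * d ^ (j + 1) / D ≤ 1 := by
        rw [div_le_one hDpos]
        have e1 : ((j + 1 : ℕ) : ℝ) ^ 3 * d ^ (j + 1) ≤ X * N :=
          hb _ _ (by positivity) (by gcongr) (by positivity) (hda.trans haa)
        linarith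
      have hjn : j + 1 ≤ n := by
        have e1 : (n : ℝ) * X = γ ^ 3 * (d : ℝ) ^ (2 * (G + 1) - 3) := by rw [hX]; field_simp
        have e2 : (1 : ℝ) ≤ (d : ℝ) ^ (2 * (G + 1) - 3) := one_le_pow₀ (by linarith)
        have e3 : γ ≤ n := by
          have e4 : γ ^ 3 * 1 ≤ γ ^ 3 * (d : ℝ) ^ (2 * (G + 1) - 3) := by gcongr
          have e5 : (n : ℝ) * X ≤ n * 1 := by gcongr; linarith
          linarith
        exact_mod_cast hkj.trans e3
      have e := le_card_cycles_mul (n := n) (d := d) (k := j + 1) hd1 hjn (by positivity) hB1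
      have hcN : (Fintype.card (MiniVertex n d) : ℝ) = (n : ℝ) * d := by rw [hcard]; push_cast; rfl
      rw [hcN]
      refine le_trans ?_ e
      have hm := mean_nonneg hd1 (j + 1)
      have hm2 := mean_mul_le (d := d) (g := G + 1) hd1 (show 1 ≤ j + 1 by omega) (by omega)
      rw [Nat.add_sub_cancel, ← ha] at hm2
      set κ : ℝ := ((j + 1 : ℕ) : ℝ) with hκ
      have hκ0 : 0 < κ := by rw [hκ]; positivity
      have e1 : mean d (j + 1) * (κ ^ 2 / n) ≤ γ * a / n := by
        rw [← mul_div_assoc]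
        refine div_le_div_of_nonneg_right ?_ hnR.le
        calc mean d (j + 1) * κ ^ 2 = mean d (j + 1) * (2 * κ) * (κ / 2) := by ring
          _ ≤ a * γ := mul_le_mul hm2 (by linarith) (by positivity) (by linarith)
          _ = γ * a := mul_comm _ _
      have e2 : mean d (j + 1) * (12 * κ ^ 3 * d ^ (j + 1) / D) ≤ 12 * (γ ^ 2 * a ^ 2) / N := by
        calc mean d (j + 1) * (12 * κ ^ 3 * d ^ (j + 1) / D)
            = (mean d (j + 1) * (2 * κ)) * (6 * κ ^ 2 * d ^ (j + 1)) / D := by ring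
          _ ≤ a * (6 * γ ^ 2 * a) / (N / 2) := by gcongr
          _ = _ := by field_simp; ring
      rw [mul_add]
      linarith
    have hsum := sum_le_sum hterm
    rw [sum_sub_distrib, sum_const, card_range, nsmul_eq_mul] at hsum
    -- Falling factorials account for at most `X` and bad matchings for at most `12 X`, so 14 leaves
    -- room.
    have : (G : ℝ) * (γ * a / n + 12 * (γ ^ 2 * a ^ 2) / N) ≤ 14 * X := by
      have e1 : (G : ℝ) * (γ * a / n) ≤ X := by
        have hle : a ≤ (d : ℝ) ^ (2 * (G + 1) - 3) := pow_le_pow_right₀ (by linarith) (by omega)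
        rw [hX, ← mul_div_assoc]
        refine div_le_div_of_nonneg_right ?_ hnR.le
        calc (G : ℝ) * (γ * a) ≤ γ * (γ * a) := by gcongr
          _ = γ ^ 2 * a := by ring
          _ ≤ _ := by gcongr
      have e2 : (G : ℝ) * (12 * (γ ^ 2 * a ^ 2) / N) ≤ 12 * X := by
        have e3 : (G : ℝ) * (γ ^ 2 * a ^ 2) ≤ γ * (γ ^ 2 * a ^ 2) := by gcongr
        rw [← mul_div_assoc, div_le_iff₀ hNpos]
        have e4 : γ * (γ ^ 2 * a ^ 2) = γ ^ 3 * a ^ 2 := by ring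
        linarith
      rw [mul_add]; linarith
    linarith

end Estimates

/-! ### From multigraphs and girth to involutions and cycles -/

section Projection

variable {n d : ℕ}

/-- The involution which exchanges the ends of every edge of a perfect matching. -/
noncomputable def partner (M : Matching n d) (u : MiniVertex n d) : MiniVertex n d :=
  (SimpleGraph.Subgraph.isPerfectMatching_iff.1 M.2 u).choose

lemma adj_iff_partner (M : Matching n d) (u w : MiniVertex n d) :
    M.1.Adj u w ↔ partner M u = w := by
  have h := (SimpleGraph.Subgraph.isPerfectMatching_iff.1 M.2 u).choose_spec
  refine ⟨fun hw => (h.2 w hw).symm, ?_⟩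
  rintro rfl
  exact h.1

lemma partner_partner (M : Matching n d) (u : MiniVertex n d) : partner M (partner M u) = u := by
  rw [← adj_iff_partner]
  exact ((adj_iff_partner M u _).2 rfl).symm

/-- Perfect matchings of the complete graph correspond to fixed-point-free involutions. -/
noncomputable def matchingEquiv (n d : ℕ) :
    Matching n d ≃ {P : Equiv.Perm (MiniVertex n d) // IsPM P} where
  toFun M := ⟨Function.Involutive.toPerm (partner M) (partner_partner M), partner_partner M,
    fun u hu => ((adj_iff_partner M u u).2 hu).ne rfl⟩
  invFun P := ⟨⟨Set.univ, fun u w => P.1 u = w, fun {u w} h => by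
      rintro rfl; exact P.2.2 u h, fun _ => Set.mem_univ _,
      ⟨fun u w (h : P.1 u = w) => P.2.eq_symm h⟩⟩,
    SimpleGraph.Subgraph.isPerfectMatching_iff.2 fun u =>
      ⟨P.1 u, rfl, fun w (h : P.1 u = w) => Eq.symm h⟩⟩
  left_inv M := by
    refine Subtype.ext (SimpleGraph.Subgraph.ext ?_ ?_)
    · exact (Set.eq_univ_of_forall M.2.2).symm
    · funext u w
      exact propext (adj_iff_partner M u w).symm
  right_inv P := by
    refine Subtype.ext (Equiv.ext fun u => ?_)
    exact (adj_iff_partner _ u _).1 rfl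

lemma project_isLink (M : Matching n d) (e : Sym2 (MiniVertex n d)) (x y : Fin n) :
    (project M).IsLink e x y ↔ ∃ u, e = s(u, (matchingEquiv n d M).1 u) ∧ u.1 = x ∧
      ((matchingEquiv n d M).1 u).1 = y := by
  have hP : ∀ u, (matchingEquiv n d M).1 u = partner M u := fun _ => rfl
  simp only [hP]
  constructor
  · rintro ⟨u, w, ⟨rfl, h⟩, rfl, rfl⟩
    have h' : M.1.Adj u w := h
    rw [adj_iff_partner] at h'
    subst h'
    exact ⟨u, rfl, rfl, rfl⟩
  · rintro ⟨u, rfl, rfl, rfl⟩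
    refine ⟨u, partner M u, ⟨rfl, ?_⟩, rfl, rfl⟩
    exact (adj_iff_partner M u _).2 rfl

lemma hasCycle_succ_iff {α β : Type*} (G : Graph α β) (k : ℕ) :
    HasCycle G (k + 1) ↔ ∃ (v : ZMod (k + 1) → α) (e : ZMod (k + 1) → β), Function.Injective v ∧
      Function.Injective e ∧ ∀ i, G.IsLink (e i) (v i) (v (i + 1)) := by
  have φ := ZMod.finEquiv (k + 1)
  constructor
  · rintro ⟨-, v, e, hv, he, hl⟩
    refine ⟨v ∘ φ.symm, e ∘ φ.symm, hv.comp φ.symm.injective, he.comp φ.symm.injective,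
      fun i => ?_⟩
    have := hl (φ.symm i)
    rw [finRotate_apply] at this
    simpa using this
  · rintro ⟨v, e, hv, he, hl⟩
    refine ⟨by omega, v ∘ φ, e ∘ φ, hv.comp φ.injective, he.comp φ.injective, fun i => ?_⟩
    have := hl (φ i)
    rw [finRotate_apply]
    simpa using this

/-- The edge `e i` leaves the class `v i` at a mini-vertex `u i`; the exit from class `i` is `u i`
and the entrance is `P (u (i - 1))`. -/
lemma hasCycle_project_iff (M : Matching n d) (k : ℕ) :
    HasCycle (project M) (k + 1) ↔ ∃ s : ZMod (k + 1) → MiniVertex n d × MiniVertex n d,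
      IsCyc Prod.fst s ∧ Follows (matchingEquiv n d M).1 s := by
  set P := (matchingEquiv n d M).1 with hPdef
  have hP : IsPM P := (matchingEquiv n d M).2
  rw [hasCycle_succ_iff]
  constructor
  · rintro ⟨v, e, hv, he, hl⟩
    simp only [project_isLink, ← hPdef] at hl
    choose u hu1 hu2 hu3 using hl
    have h3 : ∀ i, (P (u (i - 1))).1 = (u i).1 := by
      intro i
      have h := hu3 (i - 1)
      rw [sub_add_cancel] at h
      exact h.trans (hu2 i).symm
    refine ⟨fun i => (P (u (i - 1)), u i), ⟨h3, fun i hi => ?_, fun i j hij => ?_⟩, fun i => ?_⟩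
    · simp only at hi
      -- If entrance and exit coincided, two consecutive edges would be equal. Injectivity then
      -- gives `i - 1 = i`, and `P` would have a fixed point; this also covers loops.
      have h1 : e (i - 1) = e i := by
        rw [hu1, hu1, hi, hP.eq_symm hi, Sym2.eq_swap]
      rw [he h1] at hi
      exact hP.2 _ hi
    · simp only [h3] at hij
      exact hv (((hu2 i).symm.trans hij).trans (hu2 j))
    · simp
  · rintro ⟨s, hs, hf⟩
    refine ⟨fun i => (s i).2.1, fun i => s((s i).2, (s (i + 1)).1), fun i j hij => ?_,
      fun i j hij => ?_, fun i => ?_⟩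
    · refine hs.eq_of_class ?_
      rw [hs.same, hs.same]
      exact hij
    · rw [Sym2.eq_iff] at hij
      rcases hij with ⟨h, -⟩ | ⟨h, -⟩
      · refine hs.eq_of_class ?_
        rw [hs.same, hs.same, h]
      · exfalso
        have h1 : i = j + 1 := hs.eq_of_class (by rw [hs.same, h])
        rw [← h1] at h
        exact hs.ne _ h.symm
    · rw [project_isLink]
      refine ⟨(s i).2, ?_, rfl, ?_⟩
      · rw [← hPdef, hf]
      · rw [← hPdef, hf]
        exact hs.same _

lemma le_girth_iff {α β : Type*} (G : Graph α β) (g : ℕ) :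
    (g : ℕ∞) ≤ girth G ↔ ∀ k < g, ¬ HasCycle G k := by
  simp only [girth, le_iInf_iff, Nat.cast_le]
  exact forall_congr' fun k => ⟨fun h h1 h2 => absurd (h h2) (by omega),
    fun h h1 => by by_contra hc; exact h (by omega) h1⟩

lemma le_girth_project_iff (M : Matching n d) (g : ℕ) :
    (g : ℕ∞) ≤ girth (project M) ↔ (matchingEquiv n d M).1 ∈ avoid Prod.fst g ∅ := by
  set P := (matchingEquiv n d M).1 with hPdef
  have hP : IsPM P := (matchingEquiv n d M).2
  rw [le_girth_iff, avoid, mem_filter, mem_perfectMatchings]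
  simp only [notMem_empty, false_imp_iff, implies_true, and_true]
  constructor
  · refine fun h => ⟨hP, fun j hj C hC hPC => ?_⟩
    obtain ⟨s, hs, rfl⟩ := mem_cycles.1 hC
    exact h (j + 1) hj ((hasCycle_project_iff M j).2 ⟨s, hs, (contains_cycEdges hP).1 hPC⟩)
  · rintro ⟨-, h⟩ k hk hc
    obtain _ | j := k
    · exact absurd hc.1 (by omega)
    · obtain ⟨s, hs, hf⟩ := (hasCycle_project_iff M j).1 hc
      exact h j hk _ (mem_cycles.2 ⟨s, hs, rfl⟩) ((contains_cycEdges hP).2 hf)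

lemma three_le_girth_iff_simple {α β : Type*} (G : Graph α β) : 3 ≤ girth G ↔ G.Simple := by
  have h3 : (3 : ℕ∞) = ((3 : ℕ) : ℕ∞) := rfl
  rw [h3, le_girth_iff]
  constructor
  · intro h
    have h1 : ∀ e x, ¬ G.IsLoopAt e x := fun e x hl => h 1 (by omega)
      ⟨le_rfl, fun _ => x, fun _ => e, Function.injective_of_subsingleton _,
        Function.injective_of_subsingleton _, fun _ => hl⟩
    refine { not_isLoopAt := h1, eq_of_isLink := fun e f x y he hf => ?_ }
    by_contra hef
    have hxy : x ≠ y := by rintro rfl; exact h1 e x he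
    refine h 2 (by omega) ⟨by omega, ![x, y], ![e, f], ?_, ?_, ?_⟩
    · intro i j; fin_cases i <;> fin_cases j <;> simp [hxy, hxy.symm]
    · intro i j; fin_cases i <;> fin_cases j <;> simp [hef, Ne.symm hef]
    · intro i
      fin_cases i
      · exact he
      · exact hf.symm
  · rintro hG k hk ⟨hk1, v, e, hv, he, hl⟩
    obtain rfl | rfl : k = 1 ∨ k = 2 := by omega
    · have := hl 0
      rw [Subsingleton.elim (finRotate 1 0) 0] at this
      exact hG.not_isLoopAt _ _ this
    · have h0 : G.IsLink (e 0) (v 0) (v 1) := hl 0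
      have h1 : G.IsLink (e 1) (v 1) (v 0) := hl 1
      exact absurd (he (hG.eq_of_isLink h0 h1.symm)) (by simp)

lemma card_matching (n d : ℕ) :
    Nat.card (Matching n d) = (perfectMatchings (MiniVertex n d)).card := by
  rw [Nat.card_congr (matchingEquiv n d), Nat.card_eq_fintype_card, Fintype.card_subtype]
  rfl

lemma prob_le_girth (n d g : ℕ) :
    prob n d (fun G => (g : ℕ∞) ≤ girth G) =
      ((avoid (Prod.fst : MiniVertex n d → Fin n) g ∅).card : ℝ) /
        (perfectMatchings (MiniVertex n d)).card := by
  rw [prob, card_matching]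
  congr 2
  have e : {M : Matching n d // (g : ℕ∞) ≤ girth (project M)} ≃
      {P : Equiv.Perm (MiniVertex n d) // P ∈ avoid (Prod.fst : MiniVertex n d → Fin n) g ∅} :=
    ((matchingEquiv n d).subtypeEquiv (q := fun P => P.1 ∈ avoid Prod.fst g ∅)
      fun M => le_girth_project_iff M g).trans
      (Equiv.subtypeSubtypeEquivSubtype fun h => by
        rw [avoid, mem_filter, mem_perfectMatchings] at h; exact h.1)
  rw [Nat.card_congr e, Nat.card_eq_fintype_card, Fintype.card_coe]

end Projection

/-! ### The number of perfect matchings -/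

section CountMatchings

/-- This makes the perfect matchings a conjugacy class of the symmetric group, whose size is known.
-/
lemma isPM_iff_cycleType {α : Type*} [Fintype α] [DecidableEq α] {m : ℕ}
    (hm : Fintype.card α = 2 * m) (P : Equiv.Perm α) :
    IsPM P ↔ P.cycleType = Multiset.replicate m 2 := by
  constructor
  · rintro ⟨h1, h2⟩
    have hsq : P ^ 2 = 1 := by
      ext x; simp [pow_two, h1]
    have hall : ∀ a ∈ P.cycleType, a = 2 := fun a ha => by
      have e1 := Equiv.Perm.two_le_of_mem_cycleType ha
      have e2 := (Equiv.Perm.dvd_of_mem_cycleType ha).trans (orderOf_dvd_of_pow_eq_one hsq)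
      exact le_antisymm (Nat.le_of_dvd (by norm_num) e2) e1
    have hsupp : P.support = univ := by
      ext x; simpa using h2 x
    have hsum := P.sum_cycleType
    rw [hsupp, card_univ, hm, Multiset.eq_replicate_card.2 hall, Multiset.sum_replicate,
      smul_eq_mul] at hsum
    rw [Multiset.eq_replicate]
    exact ⟨by omega, hall⟩
  · intro h
    have hsq : P ^ 2 = 1 := by
      rw [← orderOf_dvd_iff_pow_eq_one, ← Equiv.Perm.lcm_cycleType, Multiset.lcm_dvd]
      intro a ha
      rw [h] at ha
      rw [Multiset.eq_of_mem_replicate ha]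
    have hsupp : P.support = univ := by
      rw [← card_eq_iff_eq_univ, ← P.sum_cycleType, h, hm, Multiset.sum_replicate, smul_eq_mul,
        mul_comm]
    refine ⟨fun x => ?_, fun x => ?_⟩
    · have := congrArg (fun Q : Equiv.Perm α => Q x) hsq
      simpa [pow_two] using this
    · rw [← Equiv.Perm.mem_support, hsupp]
      exact mem_univ x

lemma card_perfectMatchings_mul {α : Type*} [Fintype α] [DecidableEq α] {m : ℕ}
    (hm : Fintype.card α = 2 * m) :
    (perfectMatchings α).card * (m.factorial * 2 ^ m) = (2 * m).factorial := by
  have h := Equiv.Perm.card_of_cycleType_mul_eq α (Multiset.replicate m 2)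
  have e : (univ.filter fun P : Equiv.Perm α => P.cycleType = Multiset.replicate m 2) =
      perfectMatchings α := by
    ext P
    rw [mem_filter, mem_perfectMatchings, isPM_iff_cycleType hm]
    simp
  rw [e, if_pos] at h
  · rw [hm, Multiset.sum_replicate, smul_eq_mul, mul_comm m 2, Nat.sub_self,
      Multiset.prod_replicate] at h
    rw [← h]
    obtain rfl | hm0 := Nat.eq_zero_or_pos m
    · simp
    · simp [Multiset.toFinset_replicate, hm0.ne', mul_comm]
  · rw [hm, Multiset.sum_replicate, smul_eq_mul]
    exact ⟨by omega, fun a ha => (Multiset.eq_of_mem_replicate ha).ge⟩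

end CountMatchings

/-! ### Simple projections and labelled regular graphs -/

section CountGraphs

variable {n d : ℕ}

/-- The projection of a perfect matching has no loops and no parallel edges. -/
def IsSimple (P : Equiv.Perm (MiniVertex n d)) : Prop :=
  (∀ u, (P u).1 ≠ u.1) ∧ ∀ u w, u.1 = w.1 → (P u).1 = (P w).1 → u = w

lemma project_simple_iff (M : Matching n d) :
    (project M).Simple ↔ IsSimple (matchingEquiv n d M).1 := by
  have hl := project_isLink M
  set P := (matchingEquiv n d M).1 with hPdef
  have hP : IsPM P := (matchingEquiv n d M).2
  constructor
  · intro h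
    have h0 : ∀ u, (P u).1 ≠ u.1 := fun u hu =>
      h.not_isLoopAt s(u, P u) u.1 ((hl _ _ _).2 ⟨u, rfl, rfl, hu⟩)
    refine ⟨h0, fun u w huw hPuw => ?_⟩
    have h1 := h.eq_of_isLink ((hl _ _ _).2 ⟨u, rfl, rfl, rfl⟩)
      ((hl _ _ _).2 ⟨w, rfl, huw.symm, hPuw.symm⟩)
    rw [Sym2.eq_iff] at h1
    rcases h1 with ⟨h1, -⟩ | ⟨h1, -⟩
    · exact h1
    · rw [h1] at huw
      exact absurd huw (h0 w)
  · rintro ⟨h1, h2⟩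
    refine { not_isLoopAt := fun e x h => ?_, eq_of_isLink := fun e f x y he hf => ?_ }
    · obtain ⟨u, -, rfl, h⟩ := (hl _ _ _).1 h
      exact h1 u h
    · obtain ⟨u, rfl, rfl, rfl⟩ := (hl _ _ _).1 he
      obtain ⟨w, rfl, hw1, hw2⟩ := (hl _ _ _).1 hf
      rw [h2 u w hw1.symm hw2.symm]

/-- Simple graphs with a numbering of the neighbours of each vertex by `Fin d`. -/
abbrev NumberedGraph (n d : ℕ) : Type :=
  Σ G : SimpleGraph (Fin n), ∀ v, Fin d ≃ G.neighborSet v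

/-- The partner of a mini-vertex in the perfect matching given by a numbered graph. -/
def NumberedGraph.partner (x : NumberedGraph n d) (p : MiniVertex n d) : MiniVertex n d :=
  ((x.2 p.1 p.2).1, (x.2 (x.2 p.1 p.2).1).symm ⟨p.1, (x.2 p.1 p.2).2.symm⟩)

lemma NumberedGraph.partner_eq (x : NumberedGraph n d) {v w : Fin n} {i j : Fin d}
    (h1 : (x.2 v i).1 = w) (h2 : (x.2 w j).1 = v) : x.partner (v, i) = (w, j) := by
  subst h1
  refine Prod.ext rfl ?_
  simp only [partner]
  rw [Equiv.symm_apply_eq]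
  exact Subtype.ext h2.symm

lemma NumberedGraph.partner_spec (x : NumberedGraph n d) (p : MiniVertex n d) :
    (x.2 (x.partner p).1 (x.partner p).2).1 = p.1 :=
  congrArg Subtype.val (Equiv.apply_symm_apply (x.2 (x.2 p.1 p.2).1) ⟨p.1, (x.2 p.1 p.2).2.symm⟩)

lemma NumberedGraph.partner_partner (x : NumberedGraph n d) (p : MiniVertex n d) :
    x.partner (x.partner p) = p :=
  x.partner_eq (x.partner_spec p) rfl

/-- The perfect matching given by a numbered graph. -/
def NumberedGraph.toPerm (x : NumberedGraph n d) : Equiv.Perm (MiniVertex n d) :=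
  Function.Involutive.toPerm x.partner x.partner_partner

lemma NumberedGraph.isSimple (x : NumberedGraph n d) : IsSimple x.toPerm := by
  refine ⟨fun u => ((x.2 u.1 u.2).2).ne', ?_⟩
  rintro ⟨v, i⟩ ⟨w, j⟩ h1 h2
  simp only at h1
  subst h1
  have : (x.2 v i).1 = (x.2 v j).1 := h2
  rw [(x.2 v).injective (Subtype.ext this)]

lemma NumberedGraph.isPM (x : NumberedGraph n d) : IsPM x.toPerm :=
  ⟨x.partner_partner, fun u hu => x.isSimple.1 u (congrArg Prod.fst hu)⟩

lemma NumberedGraph.toPerm_injective :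
    Function.Injective (NumberedGraph.toPerm : NumberedGraph n d → _) := by
  rintro ⟨G, f⟩ ⟨G', f'⟩ h
  have h1 : ∀ v i, (f v i).1 = (f' v i).1 := fun v i =>
    congrArg (fun P : Equiv.Perm (MiniVertex n d) => (P (v, i)).1) h
  have h2 : G = G' := by
    ext v w
    constructor
    · intro hw
      have e := h1 v ((f v).symm ⟨w, hw⟩)
      rw [Equiv.apply_symm_apply] at e
      have := (f' v ((f v).symm ⟨w, hw⟩)).2
      rwa [← e] at this
    · intro hw
      have e := h1 v ((f' v).symm ⟨w, hw⟩)
      rw [Equiv.apply_symm_apply] at e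
      have := (f v ((f' v).symm ⟨w, hw⟩)).2
      rwa [e] at this
  subst h2
  congr
  funext v
  ext i : 2
  exact h1 v i

lemma exists_numberedGraph {P : Equiv.Perm (MiniVertex n d)} (hP : IsPM P) (hs : IsSimple P) :
    ∃ x : NumberedGraph n d, x.toPerm = P := by
  let G : SimpleGraph (Fin n) :=
    { Adj := fun v w => ∃ i, (P (v, i)).1 = w
      symm := ⟨fun v w => by
        rintro ⟨i, rfl⟩
        exact ⟨(P (v, i)).2, by rw [Prod.mk.eta, hP.1]⟩⟩
      loopless := ⟨fun v => by
        rintro ⟨i, hi⟩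
        exact hs.1 (v, i) hi⟩ }
  let f : ∀ v, Fin d ≃ G.neighborSet v := fun v =>
    Equiv.ofBijective (fun i => ⟨(P (v, i)).1, i, rfl⟩) ⟨fun i j hij =>
      congrArg Prod.snd (hs.2 (v, i) (v, j) rfl (congrArg Subtype.val hij)),
      fun ⟨w, i, hi⟩ => ⟨i, Subtype.ext hi⟩⟩
  refine ⟨⟨G, f⟩, Equiv.ext fun p => ?_⟩
  refine NumberedGraph.partner_eq (v := p.1) (i := p.2) (w := (P p).1) (j := (P p).2) _ rfl ?_
  change (P (P p)).1 = p.1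
  rw [hP.1]

/-- A matching with simple projection is the same as the projected graph with its neighbours
numbered: the mini-vertex `(v, i)` names the `i`th neighbour of `v`. -/
lemma card_isSimple (n d : ℕ) :
    Nat.card {P : Equiv.Perm (MiniVertex n d) // IsPM P ∧ IsSimple P} =
      Nat.card (NumberedGraph n d) :=
  (Nat.card_congr (Equiv.ofBijective
    (fun x => ⟨x.toPerm, x.isPM, x.isSimple⟩ :
      NumberedGraph n d → {P : Equiv.Perm (MiniVertex n d) // IsPM P ∧ IsSimple P})
    ⟨fun _ _ h => NumberedGraph.toPerm_injective (congrArg Subtype.val h),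
      fun ⟨_, hP, hs⟩ => (exists_numberedGraph hP hs).imp fun _ h => Subtype.ext h⟩)).symm

/-- A graph admits `(d!) ^ n` numberings if it is `d`-regular, and none otherwise. -/
lemma card_numberedGraph (n d : ℕ) :
    Nat.card (NumberedGraph n d) = numRegularGraphs n d * d.factorial ^ n := by
  classical
  have h1 : ∀ G : SimpleGraph (Fin n), Fintype.card (∀ v, Fin d ≃ G.neighborSet v) =
      if G.IsRegularOfDegree d then d.factorial ^ n else 0 := by
    intro G
    rw [Fintype.card_pi]
    split_ifs with h
    · have : ∀ v, Fintype.card (Fin d ≃ G.neighborSet v) = d.factorial := fun v => by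
        have e : Fin d ≃ G.neighborSet v := Fintype.equivOfCardEq (by
          rw [Fintype.card_fin, SimpleGraph.card_neighborSet_eq_degree, h v])
        rw [Fintype.card_equiv e, Fintype.card_fin]
      simp [this]
    · unfold SimpleGraph.IsRegularOfDegree at h
      push Not at h
      obtain ⟨v, hv⟩ := h
      refine prod_eq_zero (mem_univ v) ?_
      rw [Fintype.card_eq_zero_iff]
      refine ⟨fun e => hv ?_⟩
      have := Fintype.card_congr e
      rw [Fintype.card_fin, SimpleGraph.card_neighborSet_eq_degree] at this
      exact this.symm
  rw [Nat.card_eq_fintype_card, Fintype.card_sigma]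
  simp_rw [h1]
  rw [← sum_filter, sum_const, smul_eq_mul, numRegularGraphs, Nat.card_eq_fintype_card,
    Fintype.card_subtype]

lemma card_simple (n d : ℕ) :
    Nat.card {M : Matching n d // (project M).Simple} =
      numRegularGraphs n d * d.factorial ^ n := by
  rw [← card_numberedGraph, ← card_isSimple]
  refine Nat.card_congr (((matchingEquiv n d).subtypeEquiv (q := fun P => IsSimple P.1)
    fun M => project_simple_iff M).trans ?_)
  exact Equiv.subtypeSubtypeEquivSubtypeInter _ _

end CountGraphs

/-! ### Passage to the limit -/

open Filter Asymptotics

lemma isEquivalent_exp_of_bounds {ι : Type*} {l : Filter ι} {p m X : ι → ℝ}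
    (hX : Tendsto X l (nhds 0))
    (h : ∀ᶠ i in l, Real.exp (-m i - 14 * X i) ≤ p i ∧ p i ≤ Real.exp (-m i + 14 * X i)) :
    IsEquivalent l p fun i => Real.exp (-m i) := by
  rw [isEquivalent_iff_tendsto_one (Eventually.of_forall fun i => Real.exp_ne_zero _)]
  have h1 : Tendsto (fun i => Real.exp (-(14 * X i))) l (nhds 1) := by
    have : Tendsto (fun i => -(14 * X i)) l (nhds 0) := by simpa using (hX.const_mul 14).neg
    simpa [Function.comp_def] using (Real.continuous_exp.tendsto 0).comp this
  have h2 : Tendsto (fun i => Real.exp (14 * X i)) l (nhds 1) := by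
    have : Tendsto (fun i => 14 * X i) l (nhds 0) := by simpa using hX.const_mul 14
    simpa [Function.comp_def] using (Real.continuous_exp.tendsto 0).comp this
  refine tendsto_of_tendsto_of_tendsto_of_le_of_le' h1 h2 ?_ ?_
  · filter_upwards [h] with i hi
    rw [Pi.div_apply, le_div_iff₀ (Real.exp_pos _), ← Real.exp_add]
    exact le_trans (le_of_eq (by ring_nf)) hi.1
  · filter_upwards [h] with i hi
    rw [Pi.div_apply, div_le_iff₀ (Real.exp_pos _), ← Real.exp_add]
    exact hi.2.trans (le_of_eq (by ring_nf))

lemma card_perfectMatchings_pos {n d : ℕ} (h : Even (n * d)) :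
    0 < (perfectMatchings (MiniVertex n d)).card := by
  obtain ⟨m, hm⟩ := h
  have := card_perfectMatchings_mul (α := MiniVertex n d) (m := m) (by simp; omega)
  refine Nat.pos_of_ne_zero fun h0 => ?_
  rw [h0, zero_mul] at this
  exact Nat.factorial_ne_zero _ this.symm

lemma sum_mean_eq (d g : ℕ) :
    ∑ j ∈ range (g - 1), mean d (j + 1) =
      ∑ j ∈ Ico 1 g, ((d : ℝ) - 1) ^ j / (2 * (j : ℝ)) := by
  rw [sum_Ico_eq_sum_range]
  exact sum_congr rfl fun j _ => by rw [add_comm 1 j]; rfl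

lemma prob_le_girth_isEquivalent {ι : Type*} {l : Filter ι} {n d g : ι → ℕ}
    (hd : ∀ᶠ i in l, 3 ≤ d i) (heven : ∀ᶠ i in l, Even (n i * d i))
    (hg : ∀ᶠ i in l, 3 ≤ g i)
    (hX : IsLittleO l (fun i => (g i : ℝ) ^ 3 * (d i : ℝ) ^ (2 * g i - 3))
        (fun i => (n i : ℝ))) :
    IsEquivalent l (fun i => prob (n i) (d i) (fun G => (g i : ℕ∞) ≤ girth G))
      (fun i => Real.exp (-∑ j ∈ Ico 1 (g i), ((d i : ℝ) - 1) ^ j / (2 * (j : ℝ)))) := by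
  refine isEquivalent_exp_of_bounds hX.tendsto_div_nhds_zero ?_
  -- Positivity of `n` follows from the growth condition: where `n i = 0`, it would force a positive
  -- quantity to vanish.
  have hn : ∀ᶠ i in l, 0 < n i := by
    filter_upwards [hX.bound (c := 1) one_pos, hd, hg] with i hi hdi hgi
    by_contra hcon
    have h0 : n i = 0 := by omega
    rw [h0] at hi
    have : (0 : ℝ) < (g i : ℝ) ^ 3 * (d i : ℝ) ^ (2 * g i - 3) := by
      have h1 : (0 : ℝ) < g i := by exact_mod_cast (by omega : 0 < g i)
      have h2 : (0 : ℝ) < d i := by exact_mod_cast (by omega : 0 < d i)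
      positivity
    simp only [Nat.cast_zero, norm_zero, mul_zero, norm_le_zero_iff] at hi
    exact this.ne' hi
  have hX1 : ∀ᶠ i in l, (g i : ℝ) ^ 3 * (d i : ℝ) ^ (2 * g i - 3) / n i ≤ 1 / 100 :=
    hX.tendsto_div_nhds_zero.eventually_le_const (by norm_num)
  filter_upwards [hd, heven, hg, hn, hX1] with i hdi hei hgi hni hXi
  obtain ⟨h1, h2⟩ := card_avoid_estimate hdi hgi hni rfl hXi
  have hpos : (0 : ℝ) < (perfectMatchings (MiniVertex (n i) (d i))).card := by
    exact_mod_cast card_perfectMatchings_pos hei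
  rw [prob_le_girth, ← sum_mean_eq, le_div_iff₀ hpos, div_le_iff₀ hpos]
  exact ⟨h1, h2⟩

lemma prob_simple (n d : ℕ) :
    prob n d (fun G => G.Simple) = prob n d (fun G => ((3 : ℕ) : ℕ∞) ≤ girth G) := by
  have h : (fun G : Graph (Fin n) (Sym2 (MiniVertex n d)) => G.Simple) =
      fun G => ((3 : ℕ) : ℕ∞) ≤ girth G :=
    funext fun G => propext (three_le_girth_iff_simple G).symm
  rw [h]

lemma prob_simple_isEquivalent {ι : Type*} {l : Filter ι} {n d : ι → ℕ}
    (hd : ∀ᶠ i in l, 3 ≤ d i) (heven : ∀ᶠ i in l, Even (n i * d i))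
    (h : IsLittleO l (fun i => (d i : ℝ)) (fun i => (n i : ℝ) ^ (1 / 3 : ℝ))) :
    IsEquivalent l (fun i => prob (n i) (d i) (fun G => G.Simple))
      (fun i => Real.exp ((1 - (d i : ℝ) ^ 2) / 4)) := by
  -- For `g = 3` the growth condition is `27 d ^ 3 = o(n)`, the cube of the hypothesis up to a
  -- constant.
  have h3 : IsLittleO l (fun i => ((3 : ℕ) : ℝ) ^ 3 * (d i : ℝ) ^ (2 * 3 - 3))
      (fun i => (n i : ℝ)) := by
    have e := (h.pow (n := 3) (by norm_num)).const_mul_left (((3 : ℕ) : ℝ) ^ 3)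
    refine e.congr (fun i => rfl) fun i => ?_
    rw [← Real.rpow_natCast, ← Real.rpow_mul (Nat.cast_nonneg _)]
    norm_num
  have h4 := prob_le_girth_isEquivalent (g := fun _ => 3) hd heven
    (Eventually.of_forall fun _ => le_rfl) h3
  have h5 : (fun i => prob (n i) (d i) (fun G => G.Simple)) =
      fun i => prob (n i) (d i) (fun G => ((3 : ℕ) : ℕ∞) ≤ girth G) :=
    funext fun i => prob_simple _ _
  rw [h5]
  convert h4 using 3 with i
  -- The exponent is `(d - 1) / 2 + (d - 1) ^ 2 / 4 = (d ^ 2 - 1) / 4`.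
  have h12 : Ico 1 3 = {1, 2} := rfl
  rw [h12, sum_pair (by norm_num)]
  push_cast
  ring

lemma numRegularGraphs_eq {n d : ℕ} (h : Even (n * d)) :
    (numRegularGraphs n d : ℝ) = prob n d (fun G => G.Simple) *
      (((d * n).factorial : ℝ) / (((d * n / 2).factorial : ℝ) * 2 ^ (d * n / 2) *
        (d.factorial : ℝ) ^ n)) := by
  have hpos : (0 : ℝ) < (perfectMatchings (MiniVertex n d)).card := by
    exact_mod_cast card_perfectMatchings_pos h
  obtain ⟨m, hm⟩ := h
  have h1 := card_perfectMatchings_mul (α := MiniVertex n d) (m := m) (by simp; omega)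
  have hdn : d * n = 2 * m := by rw [mul_comm, hm]; ring
  have h2 : d * n / 2 = m := by omega
  rw [prob, card_matching, card_simple, h2, hdn, ← h1]
  push_cast
  have hd' : ((d.factorial : ℝ) ^ n) ≠ 0 := by
    have := Nat.factorial_ne_zero d
    positivity
  have hm' : ((m.factorial : ℝ) * 2 ^ m) ≠ 0 := by
    have := Nat.factorial_ne_zero m
    positivity
  have key : ∀ r a p b : ℝ, a ≠ 0 → p ≠ 0 → b ≠ 0 → r = r * a / p * (p * b / (b * a)) := by
    intro r a p b ha hp hb
    field_simp
  exact key _ _ _ _ hd' hpos.ne' hm'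

end ConfigModel

theorem theorem5p2 {ι : Type*} (l : Filter ι) (n d : ι → ℕ)
    (hd : ∀ᶠ i in l, 3 ≤ d i) (heven : ∀ᶠ i in l, Even (n i * d i)) :
    -- the probability of girth at least `g`, with `d` and `g` allowed to vary with `n`
    (∀ g : ι → ℕ, (∀ᶠ i in l, 3 ≤ g i) →
      Asymptotics.IsLittleO l (fun i => (g i : ℝ) ^ 3 * (d i : ℝ) ^ (2 * g i - 3))
        (fun i => (n i : ℝ)) →
      Asymptotics.IsEquivalent l
        (fun i => ConfigModel.prob (n i) (d i) (fun G => (g i : ℕ∞) ≤ ConfigModel.girth G))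
        (fun i => Real.exp (-∑ j ∈ Finset.Ico 1 (g i), ((d i : ℝ) - 1) ^ j / (2 * (j : ℝ))))) ∧
    -- girth at least `3` means that the multigraph is simple
    (∀ (m k : ℕ) (M : ConfigModel.Matching m k),
      3 ≤ ConfigModel.girth (ConfigModel.project M) ↔ (ConfigModel.project M).Simple) ∧
    -- the probability of simplicity and the number of labelled `d`-regular graphs
    (Asymptotics.IsLittleO l (fun i => (d i : ℝ)) (fun i => (n i : ℝ) ^ (1 / 3 : ℝ)) →
      Asymptotics.IsEquivalent l
        (fun i => ConfigModel.prob (n i) (d i) (fun G => G.Simple))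
        (fun i => Real.exp ((1 - (d i : ℝ) ^ 2) / 4)) ∧
      Asymptotics.IsEquivalent l
        (fun i => (ConfigModel.numRegularGraphs (n i) (d i) : ℝ))
        (fun i => Real.exp ((1 - (d i : ℝ) ^ 2) / 4) *
          ((Nat.factorial (d i * n i) : ℝ) /
            ((Nat.factorial (d i * n i / 2) : ℝ) * 2 ^ (d i * n i / 2) *
              (Nat.factorial (d i) : ℝ) ^ n i)))) := by
  refine ⟨fun g hg hX => ConfigModel.prob_le_girth_isEquivalent hd heven hg hX,
    fun m k M => ConfigModel.three_le_girth_iff_simple _, fun h => ?_⟩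
  have h1 := ConfigModel.prob_simple_isEquivalent hd heven h
  refine ⟨h1, ?_⟩
  refine (h1.mul Asymptotics.IsEquivalent.refl).congr_left ?_
  filter_upwards [heven] with i hi
  exact (ConfigModel.numRegularGraphs_eq hi).symm
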